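/- Let $c\ge 0$, $\kappa\in\mathbb R$. Let $\mathcal X(\mathbb R)=\{v\in H^1_{\rm loc}(\mathbb R;\mathbb C): 1-|v|^2\in L^2(\mathbb R),\ v'\in L^2(\mathbb R)\}$, and let $u\in\mathcal X(\mathbb R)$ be a weak solution of $$icu'+u''+u(1-|u|^2)+\kappa u(1-|u|^2)''=0\quad\text{in }\mathbb R,$$ that is, with $\langle z,w\rangle=\operatorname{Re}z\operatorname{Re}w+\operatorname{Im}z\operatorname{Im}w$, for all $\phi\in C_0^\infty(\mathbb R;\mathbb C)$, $$\int_{\mathbb R}\langle icu'+u(1-|u|^2),\phi\rangle-\langle u',\phi'\rangle+2\kappa\langle u,u'\rangle\langle u,\phi\rangle'\,dx=0 .$$ Set $\mathcal D_1=\{0\le c<\sqrt2,\ 0<\kappa<1/2\}$, $\mathcal D_2=\{0\le c<\sqrt2,\ \kappa\le 0\}$, $\mathcal D_3=\{c>\sqrt2,\ \kappa>1/2\}$, $\mathcal B_-=\{c=\sqrt2,\ 0<\kappa<1/2\}$, $\mathcal B_+=\{c=\sqrt2,\ \kappa>1/2\}$, $\mathcal C=\{c\ge0,\ \kappa=1/2\}$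 (sets of pairs $(c,\kappa)$) and $\tilde{\mathcal D}=\mathcal D_1\cup\mathcal D_3\cup\mathcal B_-\cup\mathcal B_+$. Assume that $(c,\kappa)\notin\tilde{\mathcal D}\cup\mathcal C$. Then, up to modification on a null set, one of the following holds. 1. $(c,\kappa)\in\mathcal D_2$, $u\in C^\infty(\mathbb R)$, and there are $x_0,\varphi\in\mathbb R$ such that $u(x)=e^{i\varphi}u_{c,\kappa}(x-x_0)$ for all $x\in\mathbb R$. Here the function $$G_{c,\kappa}(y)=-2\sqrt{-\kappa}\,\operatorname{atanh}\Big(\sqrt{-\kappa}\sqrt{\tfrac{2-c^2-2y}{1-2\kappa+2\kappa y}}\Big)+2\sqrt{\tfrac{1-2\kappa}{2-c^2}}\,\operatorname{atanh}\Big(\sqrt{\tfrac{(1-2\kappa)(2-c^2-2y)}{(2-c^2)(1-2\kappa+2\kappa y)}}\Big)$$ is a bijection from $(0,1-c^2/2]$ onto $[0,\infty)$, $\eta_{c,\kappa}(x)=G_{c,\kappa}^{-1}(|x|)$ for $x\in\mathbb R$, and the soliton is $$u_{c,\kappa}(x)=\sqrt{1-\eta_{c,\kappa}(x)}\,e^{i\theta_{c,\kappa}(x)},\qquad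 \theta_{c,\kappa}(x)=\frac c2\int_0^x\frac{\eta_{c,\kappa}(y)}{1-\eta_{c,\kappa}(y)}\,dy\qquad\text{if }c>0,$$ and $u_{0,\kappa}(x)=\pm\sqrt{1-\eta_{0,\kappa}(x)}$ for $\pm x\ge0$ if $c=0$. 2. $u$ is constant, equal to a complex number of modulus one. -/

import Mathlib

open scoped ContDiff

namespace QGP

open MeasureTheory Set

noncomputable section

/-! ## Weak derivatives, the energy space and weak solutions -/

/-- `g` is the weak (distributional) derivative on `ℝ` of the complex-valued function `v`. -/
def HasWeakDeriv (v g : ℝ → ℂ) : Prop :=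
  LocallyIntegrable v volume ∧ LocallyIntegrable g volume ∧
    ∀ ψ : ℝ → ℝ, ContDiff ℝ ∞ ψ → HasCompactSupport ψ →
      ∫ x, deriv ψ x • v x = -∫ x, ψ x • g x

/-- `L²_loc(ℝ; ℂ)`. -/
def L2loc : Set (ℝ → ℂ) :=
  {v | ∀ K : Set ℝ, IsCompact K → MemLp v 2 (volume.restrict K)}

/-- `H¹_loc(ℝ; ℂ)`. -/
def H1loc : Set (ℝ → ℂ) :=
  {v | v ∈ L2loc ∧ ∃ g ∈ L2loc, HasWeakDeriv v g}

/-- The energy space `X(ℝ) = {v ∈ H¹_loc(ℝ) : 1 - |v|² ∈ L²(ℝ), v' ∈ L²(ℝ)}`. Its elements are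
functions defined up to equality almost everywhere; no continuity is imposed. -/
def EnergySpace : Set (ℝ → ℂ) :=
  {v | v ∈ H1loc ∧ MemLp (fun x => 1 - ‖v x‖ ^ 2) 2 volume ∧
    ∃ g : ℝ → ℂ, HasWeakDeriv v g ∧ MemLp g 2 volume}

/-- `u` is a weak solution of `i c u' + u'' + u (1 - |u|²) + κ u (1 - |u|²)'' = 0`, that is,
`∫ ⟨i c u' + u (1 - |u|²), φ⟩ - ⟨u', φ'⟩ + 2 κ ⟨u, u'⟩ ⟨u, φ⟩' = 0` for all
`φ ∈ C₀^∞(ℝ; ℂ)`. Here `⟨z, w⟩ = Re z Re w + Im z Im w`, `g` is the weak derivative `u'`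
(unique up to null sets), and `⟨u, φ⟩' = ⟨u', φ⟩ + ⟨u, φ'⟩`. -/
def IsWeakSolution (c κ : ℝ) (u : ℝ → ℂ) : Prop :=
  ∃ g : ℝ → ℂ, HasWeakDeriv u g ∧
    ∀ φ : ℝ → ℂ, ContDiff ℝ ∞ φ → HasCompactSupport φ →
      ∫ x, (inner ℝ (Complex.I * (c : ℂ) * g x + u x * ((1 - ‖u x‖ ^ 2 : ℝ) : ℂ)) (φ x)
          - inner ℝ (g x) (deriv φ x)
          + 2 * κ * inner ℝ (u x) (g x)
              * (inner ℝ (g x) (φ x) + inner ℝ (u x) (deriv φ x))) = 0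

/-! ## Parameter regions (pairs `(c, κ)`) -/

def D1 : Set (ℝ × ℝ) := {p | 0 ≤ p.1 ∧ p.1 < √2 ∧ 0 < p.2 ∧ p.2 < 1 / 2}

def D2 : Set (ℝ × ℝ) := {p | 0 ≤ p.1 ∧ p.1 < √2 ∧ p.2 ≤ 0}

def D3 : Set (ℝ × ℝ) := {p | √2 < p.1 ∧ 1 / 2 < p.2}

def Bminus : Set (ℝ × ℝ) := {p | p.1 = √2 ∧ 0 < p.2 ∧ p.2 < 1 / 2}

def Bplus : Set (ℝ × ℝ) := {p | p.1 = √2 ∧ 1 / 2 < p.2}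

def Dtilde : Set (ℝ × ℝ) := D1 ∪ D3 ∪ Bminus ∪ Bplus

def Ccrit : Set (ℝ × ℝ) := {p | 0 ≤ p.1 ∧ p.2 = 1 / 2}

/-! ## The explicit dark soliton for `(c, κ) ∈ D2` -/

/-- The interval `(0, 1 - c²/2]`. -/
def Ic (c : ℝ) : Set ℝ := Ioc 0 (1 - c ^ 2 / 2)

/-- The function `G_{c,κ}`, to be used on `Ic c` for `(c, κ) ∈ D2`. -/
def G (c κ y : ℝ) : ℝ :=
  -2 * √(-κ) * Real.artanh (√(-κ) * √((2 - c ^ 2 - 2 * y) / (1 - 2 * κ + 2 * κ * y)))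
    + 2 * √((1 - 2 * κ) / (2 - c ^ 2))
      * Real.artanh (√(((1 - 2 * κ) * (2 - c ^ 2 - 2 * y))
          / ((2 - c ^ 2) * (1 - 2 * κ + 2 * κ * y))))

/-- The intensity profile `η_{c,κ}`: the even extension to `ℝ` of the inverse of
`G_{c,κ} : (0, 1 - c²/2] → [0, ∞)`. -/
def eta (c κ x : ℝ) : ℝ := Function.invFunOn (G c κ) (Ic c) |x|

/-- The phase `θ_{c,κ}(x) = (c/2) ∫₀ˣ η_{c,κ} / (1 - η_{c,κ})`. -/
def theta (c κ x : ℝ) : ℝ := c / 2 * ∫ y in (0 : ℝ)..x, eta c κ y / (1 - eta c κ y)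

/-- The dark soliton `u_{c,κ}`: for `c ≠ 0` it is `√(1 - η_{c,κ}) e^{i θ_{c,κ}}`, and for
`c = 0` it is the real odd function equal to `±√(1 - η_{0,κ}(x))` for `±x ≥ 0` (the black
soliton; `η_{0,κ}(0) = 1`). -/
def soliton (c κ x : ℝ) : ℂ :=
  if c = 0 then
    (if 0 ≤ x then ((√(1 - eta 0 κ x) : ℝ) : ℂ) else ((-√(1 - eta 0 κ x) : ℝ) : ℂ))
  else ((√(1 - eta c κ x) : ℝ) : ℂ) * Complex.exp (Complex.I * (theta c κ x : ℂ))

end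

end QGP

/-! ### Weak derivatives and primitives -/

namespace QGP

open MeasureTheory Set Filter Topology

/-! The weak equation says that the flux `F = u' - 2κ⟨u, u'⟩u` has a locally integrable weak
derivative. Where `1 - 2κ|u|² ≠ 0`, the velocity `u'` is recovered algebraically from `u` and `F`,
so `(u, F)` solves a first-order ODE system (`exists_weakProfile`, `velocity_flux`).

The system has two first integrals, an angular momentum and an energy. Finite energy forces both
constants to vanish on nondegenerate half-lines reaching `+∞`. Lagrange's identity combines them
into a scalar equation for `η = 1 - |u|²`, namely `η'² (1 - 2κ + 2κη) = η² (2 - c² - 2η)`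
(`intensity_eq`).

Moreover `|u| → 1` at both ends (`tendsto_norm_sq`). If `(1 - 2κ)(2 - c²) < 0`, the two sides have
opposite signs far out, so `η = 0` there, and this propagates to the whole line. The parameters
still allowed satisfy `κ ≤ 0` and `c ≤ √2`, and then nothing degenerates. If `η` is not identically
zero, `η²` has a positive maximum, where the equation forces `η = 1 - c²/2`; this excludes `c = √2`.
For `c < √2`, a Gronwall bound keeps `η` positive, the maximum is the only critical point, and
separation of variables gives `G(η(x)) = |x - x₀|`.

The angular momentum then prescribes the phase velocity. For `c > 0` the solution has no zero and
its phase is global; for `c = 0` it vanishes at `x₀` only, and the nonzero derivative there makes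
the phases on the two sides opposite. -/

theorem integral_deriv_mul_primitive {h ψ : ℝ → ℝ} (hh : LocallyIntegrable h volume)
    (hψ : ContDiff ℝ ∞ ψ) (hc : HasCompactSupport ψ) :
    ∫ x, deriv ψ x * ∫ t in (0 : ℝ)..x, h t = -∫ x, ψ x * h x := by
  obtain ⟨R, hR⟩ := hc.isCompact.isBounded.subset_ball (0 : ℝ)
  rw [Real.ball_eq_Ioo, zero_sub, zero_add] at hR
  have hR' : tsupport ψ ⊆ Ioc (-R) R := hR.trans Ioo_subset_Ioc_self
  have hint (x y : ℝ) : IntervalIntegrable h volume x y :=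
    intervalIntegrable_iff.mpr <|
      (hh.integrableOn_isCompact isCompact_uIcc).mono_set uIoc_subset_uIcc
  have hz (x : ℝ) (hx : x ∉ Ioo (-R) R) : ψ x = 0 :=
    image_eq_zero_of_notMem_tsupport fun h => hx (hR h)
  have e1 : ∫ x, deriv ψ x * ∫ t in (0 : ℝ)..x, h t
      = ∫ x in (-R)..R, deriv ψ x * ∫ t in (0 : ℝ)..x, h t := by
    refine (intervalIntegral.integral_eq_integral_of_support_subset ?_).symm
    exact (Function.support_mul_subset_left _ _).trans
      ((support_deriv_subset).trans hR')
  have e2 : ∫ x, ψ x * h x = ∫ x in (-R)..R, ψ x * h x := by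
    refine (intervalIntegral.integral_eq_integral_of_support_subset ?_).symm
    exact (Function.support_mul_subset_left _ _).trans ((subset_tsupport ψ).trans hR')
  have acψ : AbsolutelyContinuousOnInterval ψ (-R) R := by
    obtain ⟨C, hC⟩ := (hψ.of_le (by simp) : ContDiff ℝ 1 ψ).lipschitzWith_of_hasCompactSupport hc
      one_ne_zero
    exact hC.lipschitzOnWith.absolutelyContinuousOnInterval
  have acV : AbsolutelyContinuousOnInterval (fun x => ∫ t in (0 : ℝ)..x, h t) (-R) R := by
    have := ((hint (-R) R).absolutelyContinuousOnInterval_intervalIntegral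
      (c := -R) left_mem_uIcc)
    have h2 : (fun x => ∫ t in (0 : ℝ)..x, h t)
        = fun x => (∫ t in (-R)..x, h t) - ∫ t in (-R)..0, h t := by
      ext x
      rw [eq_sub_iff_add_eq, add_comm, intervalIntegral.integral_add_adjacent_intervals] <;>
        exact hint _ _
    rw [h2]
    exact this.sub (LipschitzWith.const _).lipschitzOnWith.absolutelyContinuousOnInterval
  have key := AbsolutelyContinuousOnInterval.integral_mul_deriv_eq_deriv_mul acψ acV
  rw [hz R (by simp), hz (-R) (by simp)] at key
  have e3 : ∫ x in (-R)..R, ψ x * deriv (fun x => ∫ t in (0 : ℝ)..x, h t) x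
      = ∫ x in (-R)..R, ψ x * h x := by
    apply intervalIntegral.integral_congr_ae
    filter_upwards [LocallyIntegrable.ae_hasDerivAt_integral hh] with x hx _
    rw [(hx 0).deriv]
  rw [e1, e2, ← e3, key]; ring

/-- A locally integrable function with vanishing distributional derivative is constant. -/
theorem exists_ae_eq_const {E : Type*} [NormedAddCommGroup E] [NormedSpace ℝ E]
    [CompleteSpace E] {w : ℝ → E} (hw : LocallyIntegrable w volume)
    (h : ∀ ψ : ℝ → ℝ, ContDiff ℝ ∞ ψ → HasCompactSupport ψ → ∫ x, deriv ψ x • w x = 0) :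
    ∃ C : E, ∀ᵐ x, w x = C := by
  let b : ContDiffBump (0 : ℝ) := ⟨1, 2, one_pos, one_lt_two⟩
  set φ₀ : ℝ → ℝ := b.normed volume with hφ₀
  have hφs : ContDiff ℝ ∞ φ₀ := b.contDiff_normed
  have hφc : HasCompactSupport φ₀ := b.hasCompactSupport_normed
  have hφi : ∫ x, φ₀ x = 1 := b.integral_normed
  -- The constant is the mean of `w` against a normalised bump. Subtracting `m * φ₀` from a test
  -- function leaves integral zero, hence the derivative of a compactly supported function.
  refine ⟨∫ x, φ₀ x • w x, ?_⟩
  refine ae_eq_of_integral_contDiff_smul_eq hw (locallyIntegrable_const _) fun φ hφ hc => ?_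
  set m := ∫ x, φ x with hm
  let f : ℝ → ℝ := fun x => φ x - m * φ₀ x
  have hf : ContDiff ℝ ∞ f := hφ.sub (contDiff_const.mul hφs)
  have hfc : HasCompactSupport f := hc.sub (hφc.mul_left)
  have hf0 : ∫ x, f x = 0 := by
    simp only [f]
    rw [integral_sub (hφ.continuous.integrable_of_hasCompactSupport hc)
      ((hφs.continuous.integrable_of_hasCompactSupport hφc).const_mul m), integral_const_mul, hφi]
    simp [hm]
  obtain ⟨R, hR⟩ := hfc.isCompact.isBounded.subset_ball (0 : ℝ)
  rw [Real.ball_eq_Ioo, zero_sub, zero_add] at hR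
  have hz (x : ℝ) (hx : x ∉ Ioo (-R) R) : f x = 0 :=
    image_eq_zero_of_notMem_tsupport fun h => hx (hR h)
  let ψ : ℝ → ℝ := fun x => ∫ t in (-R)..x, f t
  have hψd (x : ℝ) : HasDerivAt ψ (f x) x :=
    intervalIntegral.integral_hasDerivAt_right (hf.continuous.intervalIntegrable _ _)
      (hf.continuous.stronglyMeasurableAtFilter _ _) hf.continuous.continuousAt
  have hψf : deriv ψ = f := funext fun x => (hψd x).deriv
  have hψs : ContDiff ℝ ∞ ψ := by
    rw [contDiff_infty_iff_deriv]
    exact ⟨fun x => (hψd x).differentiableAt, hψf ▸ hf⟩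
  have hψc : HasCompactSupport ψ := by
    refine HasCompactSupport.intro (isCompact_Icc : IsCompact (Icc (-R) R)) fun x hx => ?_
    rcases lt_or_ge x (-R) with h1 | h1
    · refine (intervalIntegral.integral_congr (g := fun _ => 0) fun t ht => hz t ?_).trans (by simp)
      rw [uIcc_of_ge h1.le] at ht
      exact fun h => absurd h.1 (not_lt.2 ht.2)
    · have h2 : R < x := by
        by_contra h2
        exact hx ⟨h1, not_lt.1 h2⟩
      change ∫ t in (-R)..x, f t = 0
      rw [intervalIntegral.integral_eq_integral_of_support_subset, hf0]
      intro t ht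
      have : t ∈ Ioo (-R) R := by
        by_contra h
        exact ht (hz t h)
      exact ⟨this.1, this.2.le.trans h2.le⟩
  have := h ψ hψs hψc
  rw [hψf] at this
  simp only [f, sub_smul, mul_smul] at this
  have e := integral_sub (hw.integrable_smul_left_of_hasCompactSupport hφ.continuous hc)
    ((hw.integrable_smul_left_of_hasCompactSupport hφs.continuous hφc).smul m)
  simp only [Pi.smul_apply] at e
  rw [e, integral_smul, sub_eq_zero] at this
  rw [this, integral_smul_const]

/-- A function with a weak derivative is a.e. equal to a primitive of it. -/
theorem HasWeakDeriv.exists_ae_eq_primitive {v g : ℝ → ℂ} (h : HasWeakDeriv v g) :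
    ∃ C : ℂ, ∀ᵐ x, v x = C + ∫ t in (0 : ℝ)..x, g t := by
  obtain ⟨hv, hg, hvg⟩ := h
  have hint (x y : ℝ) : IntervalIntegrable g volume x y :=
    intervalIntegrable_iff.mpr <|
      (hg.integrableOn_isCompact isCompact_uIcc).mono_set uIoc_subset_uIcc
  have hcont : Continuous fun x => ∫ t in (0 : ℝ)..x, g t :=
    intervalIntegral.continuous_primitive hint 0
  have hre : LocallyIntegrable (fun x => (g x).re) volume := fun x => by
    obtain ⟨s, hs, hi⟩ := hg x
    exact ⟨s, hs, Complex.reCLM.integrable_comp hi⟩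
  have him : LocallyIntegrable (fun x => (g x).im) volume := fun x => by
    obtain ⟨s, hs, hi⟩ := hg x
    exact ⟨s, hs, Complex.imCLM.integrable_comp hi⟩
  obtain ⟨C, hC⟩ := exists_ae_eq_const (w := fun x => v x - ∫ t in (0 : ℝ)..x, g t)
    (hv.sub hcont.locallyIntegrable) fun ψ hψ hc => by
      have hdc : Continuous (deriv ψ) := hψ.continuous_deriv (by simp)
      have i1 := hv.integrable_smul_left_of_hasCompactSupport hdc hc.deriv
      have i2 := hcont.locallyIntegrable.integrable_smul_left_of_hasCompactSupport
        (μ := volume) hdc hc.deriv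
      have i3 := hg.integrable_smul_left_of_hasCompactSupport hψ.continuous hc
      simp only [smul_sub]
      rw [integral_sub i1 i2, hvg ψ hψ hc, sub_eq_zero]
      have eqre := integral_deriv_mul_primitive hre hψ hc
      have eqim := integral_deriv_mul_primitive him hψ hc
      have c1 := Complex.reCLM.integral_comp_comm i2
      have c2 := Complex.imCLM.integral_comp_comm i2
      have c3 := Complex.reCLM.integral_comp_comm i3
      have c4 := Complex.imCLM.integral_comp_comm i3
      have d1 (x : ℝ) := Complex.reCLM.intervalIntegral_comp_comm (hint 0 x)
      have d2 (x : ℝ) := Complex.imCLM.intervalIntegral_comp_comm (hint 0 x)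
      simp only [Complex.reCLM_apply, Complex.imCLM_apply, Complex.smul_re, Complex.smul_im,
        smul_eq_mul] at c1 c2 c3 c4 d1 d2
      apply Complex.ext
      · rw [Complex.neg_re, ← c1, ← c3, ← eqre]
        simp only [d1]
      · rw [Complex.neg_im, ← c2, ← c4, ← eqim]
        simp only [d2]
  refine ⟨C, ?_⟩
  filter_upwards [hC] with x hx
  rw [← hx]; ring

theorem HasWeakDeriv.ae_unique {v g g' : ℝ → ℂ} (h : HasWeakDeriv v g) (h' : HasWeakDeriv v g') :
    g =ᵐ[volume] g' :=
  ae_eq_of_integral_contDiff_smul_eq h.2.1 h'.2.1 fun ψ hψ hc =>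
    neg_injective ((h.2.2 ψ hψ hc).symm.trans (h'.2.2 ψ hψ hc))

/-! ### Absolutely continuous form of the equation -/

/-- The velocity `w` recovered from `z` and the flux `f = w - 2κ⟨z, w⟩z`. -/
noncomputable def velocity (κ : ℝ) (z f : ℂ) : ℂ :=
  f + (2 * κ * inner ℝ z f / (1 - 2 * κ * ‖z‖ ^ 2)) • z

/-- The derivative of the flux `w - 2κ⟨z, w⟩z` prescribed by the equation, in terms of the value
`z` and the velocity `w` of the solution. -/
noncomputable def source (c κ : ℝ) (z w : ℂ) : ℂ :=
  -(Complex.I * (c : ℂ) * w + z * ((1 - ‖z‖ ^ 2 : ℝ) : ℂ) + (2 * κ * inner ℝ z w) • w)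

/-- Absolutely continuous form of the equation: `U` is the solution, `g` its derivative and `F` the
flux. -/
structure WeakProfile (c κ : ℝ) (U F g : ℝ → ℂ) : Prop where
  memLp : MemLp g 2 volume
  integrable_sq : Integrable (fun x => (1 - ‖U x‖ ^ 2) ^ 2) volume
  locallyIntegrable_source : LocallyIntegrable (fun x => source c κ (U x) (g x)) volume
  eq_primitive : ∀ x, U x = U 0 + ∫ t in (0 : ℝ)..x, g t
  flux_eq_primitive : ∀ x, F x = F 0 + ∫ t in (0 : ℝ)..x, source c κ (U t) (g t)
  flux_eq : ∀ᵐ x, F x = g x - (2 * κ * inner ℝ (U x) (g x)) • U x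

/-- Test functions `ψ • e` with `ψ` real and `e` a fixed vector turn the weak equation into the
statement that the flux has weak derivative `source`. The profile is then made of the continuous
primitives. The quadratic term of `source` is locally integrable because `U` is continuous and `g`
is in `L²`. -/
theorem exists_weakProfile {c κ : ℝ} {u : ℝ → ℂ} (hu : u ∈ EnergySpace)
    (hsol : IsWeakSolution c κ u) :
    ∃ U F g : ℝ → ℂ, u =ᵐ[volume] U ∧ WeakProfile c κ U F g := by
  obtain ⟨-, hη, g', hg', hg'2⟩ := hu
  obtain ⟨g, hg, hw⟩ := hsol
  have hg2 : MemLp g 2 volume := hg'2.ae_eq (hg'.ae_unique hg)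
  obtain ⟨C, hC⟩ := hg.exists_ae_eq_primitive
  have hgl := hg.2.1
  have hint (x y : ℝ) : IntervalIntegrable g volume x y :=
    intervalIntegrable_iff.mpr <|
      (hgl.integrableOn_isCompact isCompact_uIcc).mono_set uIoc_subset_uIcc
  set U : ℝ → ℂ := fun x => C + ∫ t in (0 : ℝ)..x, g t with hU
  have hUc : Continuous U := continuous_const.add (intervalIntegral.continuous_primitive hint 0)
  have huU : u =ᵐ[volume] U := hC
  have hgm : AEStronglyMeasurable g volume := hg2.1
  have hg2i : Integrable (fun x => ‖g x‖ ^ 2) volume := hg2.integrable_norm_pow two_ne_zero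
  have hUm : AEStronglyMeasurable U volume := hUc.aestronglyMeasurable
  have hinm : AEStronglyMeasurable (fun x => inner ℝ (U x) (g x)) volume := hUm.inner hgm
  have hloc1 : LocallyIntegrable (fun x => (2 * κ * inner ℝ (U x) (g x)) • g x) volume := by
    have h1 : LocallyIntegrable (fun x => (2 * |κ| * ‖U x‖) • (‖g x‖ ^ 2)) volume :=
      (hg2i.locallyIntegrable.locallyIntegrableOn univ).continuousOn_smul
        isOpen_univ.isLocallyClosed
        ((continuous_const.mul hUc.norm).continuousOn) |> locallyIntegrableOn_univ.1
    refine h1.mono ((hinm.const_mul (2 * κ)).smul hgm) (Eventually.of_forall fun x => ?_)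
    rw [norm_smul, smul_eq_mul, norm_mul, norm_mul, norm_mul]
    simp only [Real.norm_eq_abs, abs_mul, abs_abs, abs_norm, abs_pow, abs_two]
    nlinarith [mul_le_mul_of_nonneg_left (abs_real_inner_le_norm (U x) (g x))
      (mul_nonneg (mul_nonneg zero_le_two (abs_nonneg κ)) (norm_nonneg (g x)))]
  have hloc2 : LocallyIntegrable (fun x => (2 * κ * inner ℝ (U x) (g x)) • U x) volume := by
    have h1 : LocallyIntegrable (fun x => (2 * |κ| * ‖U x‖ ^ 2) • g x) volume :=
      (hgl.locallyIntegrableOn univ).continuousOn_smul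
        isOpen_univ.isLocallyClosed
        ((continuous_const.mul (hUc.norm.pow 2)).continuousOn) |> locallyIntegrableOn_univ.1
    refine h1.mono ((hinm.const_mul (2 * κ)).smul hUm) (Eventually.of_forall fun x => ?_)
    rw [norm_smul, norm_smul, norm_mul, norm_mul]
    simp only [Real.norm_eq_abs, abs_mul, abs_abs, abs_norm, abs_pow, abs_two]
    nlinarith [mul_le_mul_of_nonneg_left (abs_real_inner_le_norm (U x) (g x))
      (mul_nonneg (mul_nonneg zero_le_two (abs_nonneg κ)) (norm_nonneg (U x)))]
  have hsrc : LocallyIntegrable (fun x => source c κ (U x) (g x)) volume := by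
    have h1 : LocallyIntegrable (fun x => Complex.I * (c : ℂ) * g x) volume :=
      hgl.smul (Complex.I * (c : ℂ))
    have h2 : Continuous fun x => U x * ((1 - ‖U x‖ ^ 2 : ℝ) : ℂ) := by fun_prop
    exact ((h1.add h2.locallyIntegrable).add hloc1).neg
  have hflux : LocallyIntegrable (fun x => g x - (2 * κ * inner ℝ (U x) (g x)) • U x) volume :=
    hgl.sub hloc2
  have hweak : HasWeakDeriv (fun x => g x - (2 * κ * inner ℝ (U x) (g x)) • U x)
      (fun x => source c κ (U x) (g x)) := by
    refine ⟨hflux, hsrc, fun ψ hψ hc => ?_⟩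
    have i1 := hflux.integrable_smul_left_of_hasCompactSupport
      (hψ.continuous_deriv (by simp)) hc.deriv
    have i2 := hsrc.integrable_smul_left_of_hasCompactSupport hψ.continuous hc
    have key (e : ℂ) : inner ℝ e (∫ x, deriv ψ x • (g x - (2 * κ * inner ℝ (U x) (g x)) • U x))
        = inner ℝ e (-∫ x, ψ x • source c κ (U x) (g x)) := by
      have hd (x : ℝ) : HasDerivAt (fun x => (ψ x) • e) (deriv ψ x • e) x :=
        ((hψ.differentiable (by simp)) x).hasDerivAt.smul_const e
      have h := hw (fun x => (ψ x) • e) (hψ.smul contDiff_const) hc.smul_right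
      have h' : ∫ x, (inner ℝ e (deriv ψ x • (g x - (2 * κ * inner ℝ (U x) (g x)) • U x))
          + inner ℝ e (ψ x • source c κ (U x) (g x))) = 0 := by
        rw [← neg_eq_zero, ← integral_neg, ← h]
        refine integral_congr_ae ?_
        filter_upwards [huU] with x hx
        rw [hx, (hd x).deriv]
        simp only [source, Complex.inner, Complex.mul_re, Complex.mul_im, Complex.conj_re,
          Complex.conj_im, Complex.smul_re, Complex.smul_im, Complex.neg_re, Complex.neg_im,
          Complex.add_re, Complex.add_im, Complex.sub_re, Complex.sub_im, Complex.I_re,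
          Complex.I_im, Complex.ofReal_re, Complex.ofReal_im, smul_eq_mul]
        ring
      rw [integral_add (i1.const_inner e) (i2.const_inner e), integral_inner i1,
        integral_inner i2] at h'
      rw [inner_neg_right]
      linarith
    exact ext_inner_left ℝ key
  obtain ⟨D, hD⟩ := hweak.exists_ae_eq_primitive
  refine ⟨U, fun x => D + ∫ t in (0 : ℝ)..x, source c κ (U t) (g t), g, huU, hg2, ?_, hsrc,
    fun x => by simp [hU], fun x => by simp, hD.mono fun x hx => hx.symm⟩
  refine (hη.integrable_norm_pow two_ne_zero).congr ?_
  filter_upwards [huU] with x hx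
  rw [hx, Real.norm_eq_abs]
  exact sq_abs _

namespace WeakProfile

variable {c κ : ℝ} {U F g : ℝ → ℂ}

theorem intervalIntegrable (h : WeakProfile c κ U F g) (x y : ℝ) :
    IntervalIntegrable g volume x y :=
  intervalIntegrable_iff.mpr <|
    ((h.memLp.locallyIntegrable one_le_two).integrableOn_isCompact isCompact_uIcc).mono_set
      uIoc_subset_uIcc

theorem intervalIntegrable_source (h : WeakProfile c κ U F g) (x y : ℝ) :
    IntervalIntegrable (fun x => source c κ (U x) (g x)) volume x y :=
  intervalIntegrable_iff.mpr <|
    (h.locallyIntegrable_source.integrableOn_isCompact isCompact_uIcc).mono_set uIoc_subset_uIcc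

theorem continuous (h : WeakProfile c κ U F g) : Continuous U := by
  rw [funext h.eq_primitive]
  exact continuous_const.add (intervalIntegral.continuous_primitive h.intervalIntegrable 0)

theorem continuous_flux (h : WeakProfile c κ U F g) : Continuous F := by
  rw [funext h.flux_eq_primitive]
  exact continuous_const.add
    (intervalIntegral.continuous_primitive h.intervalIntegrable_source 0)

end WeakProfile

/-! ### Modulus at infinity -/

theorem tendsto_window_atTop {f : ℝ → ℝ} (hf : Integrable f volume) :
    Tendsto (fun x => ∫ t in x..x + 1, f t) atTop (𝓝 0) := by
  have h1 := intervalIntegral_tendsto_integral_Ioi (0 : ℝ) hf.integrableOn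
    (tendsto_id : Tendsto (fun x : ℝ => x) atTop atTop)
  have h2 := intervalIntegral_tendsto_integral_Ioi (0 : ℝ) hf.integrableOn
    (tendsto_atTop_add_const_right _ (1 : ℝ) (tendsto_id : Tendsto (fun x : ℝ => x) atTop atTop))
  have h3 := h2.sub h1
  rw [sub_self] at h3
  refine h3.congr fun x => ?_
  exact intervalIntegral.integral_interval_sub_left hf.intervalIntegrable hf.intervalIntegrable

theorem tendsto_window_atBot {f : ℝ → ℝ} (hf : Integrable f volume) :
    Tendsto (fun x => ∫ t in x..x + 1, f t) atBot (𝓝 0) := by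
  have h1 := intervalIntegral_tendsto_integral_Iic (0 : ℝ) hf.integrableOn
    (tendsto_id : Tendsto (fun x : ℝ => x) atBot atBot)
  have h2 := intervalIntegral_tendsto_integral_Iic (0 : ℝ) hf.integrableOn
    (tendsto_atBot_add_const_right _ (1 : ℝ) (tendsto_id : Tendsto (fun x : ℝ => x) atBot atBot))
  have h3 := h1.sub h2
  rw [sub_self] at h3
  refine h3.congr fun x => ?_
  exact sub_eq_iff_eq_add.2 (intervalIntegral.integral_add_adjacent_intervals
    hf.intervalIntegrable hf.intervalIntegrable).symm

/-- On a distant unit window, small potential energy gives a point with modulus near one, and small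
kinetic energy bounds the oscillation of `U`. Both ends of the line are covered by the hypothesis on
windows. -/
theorem WeakProfile.tendsto_norm_sq {c κ : ℝ} {U F g : ℝ → ℂ} (h : WeakProfile c κ U F g)
    {l : Filter ℝ}
    (hl : ∀ f : ℝ → ℝ, Integrable f volume → Tendsto (fun x => ∫ t in x..x + 1, f t) l (𝓝 0)) :
    Tendsto (fun x => ‖U x‖ ^ 2) l (𝓝 1) := by
  have hU := h.continuous
  have hg2 : Integrable (fun x => ‖g x‖ ^ 2) volume := h.memLp.integrable_norm_pow two_ne_zero
  have key : Tendsto (fun x => ‖U x‖) l (𝓝 1) := by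
    rw [Metric.tendsto_nhds]
    intro ε hε
    have e1 := (hl _ hg2).eventually (gt_mem_nhds (show (0 : ℝ) < (ε / 4) ^ 2 by positivity))
    have e2 := (hl _ h.integrable_sq).eventually
      (gt_mem_nhds (show (0 : ℝ) < (ε / 2) ^ 2 by positivity))
    filter_upwards [e1, e2] with x h1 h2
    -- A point of `[x, x + 1]` where the modulus is close to one.
    obtain ⟨y, hy, hy2⟩ : ∃ y ∈ Icc x (x + 1), (1 - ‖U y‖ ^ 2) ^ 2 < (ε / 2) ^ 2 := by
      by_contra! hcon
      have := intervalIntegral.integral_mono_on (μ := volume) (by linarith : x ≤ x + 1)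
        (intervalIntegrable_const (c := (ε / 2) ^ 2)) h.integrable_sq.intervalIntegrable hcon
      rw [intervalIntegral.integral_const, add_sub_cancel_left, one_smul] at this
      linarith
    have hy3 : |1 - ‖U y‖| < ε / 2 := by
      have h3 := abs_lt_of_sq_lt_sq hy2 (by positivity)
      have h4 : |1 - ‖U y‖ ^ 2| = |1 - ‖U y‖| * (1 + ‖U y‖) := by
        rw [← abs_of_nonneg (by positivity : 0 ≤ 1 + ‖U y‖), ← abs_mul]; ring_nf
      nlinarith [abs_nonneg (1 - ‖U y‖), norm_nonneg (U y)]
    have hd : U y - U x = ∫ t in x..y, g t := by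
      rw [h.eq_primitive y, h.eq_primitive x, add_sub_add_left_eq_sub]
      exact intervalIntegral.integral_interval_sub_left (h.intervalIntegrable _ _)
        (h.intervalIntegrable _ _)
    have hn : ‖U y - U x‖ ≤ ∫ t in x..x + 1, ‖g t‖ := by
      rw [hd]
      refine (intervalIntegral.norm_integral_le_integral_norm hy.1).trans ?_
      exact intervalIntegral.integral_mono_interval le_rfl hy.1 hy.2
        (Eventually.of_forall fun t => norm_nonneg _) (h.intervalIntegrable _ _).norm
    -- Young's inequality in place of Cauchy–Schwarz; the weights make the oscillation less than `ε
    -- / 8 + ε / 8`.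
    have hn2 : ∫ t in x..x + 1, ‖g t‖ ≤ ∫ t in x..x + 1, (ε / 8 + 2 / ε * ‖g t‖ ^ 2) := by
      refine intervalIntegral.integral_mono_on (by linarith) (h.intervalIntegrable _ _).norm
        (intervalIntegrable_const.add (hg2.intervalIntegrable.const_mul _)) fun t _ => ?_
      have : ε / 8 + 2 / ε * ‖g t‖ ^ 2 - ‖g t‖ = 2 / ε * (‖g t‖ - ε / 4) ^ 2 := by
        field_simp; ring
      have : 0 ≤ 2 / ε * (‖g t‖ - ε / 4) ^ 2 := by positivity
      linarith
    rw [intervalIntegral.integral_add intervalIntegrable_const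
      (hg2.intervalIntegrable.const_mul _), intervalIntegral.integral_const,
      intervalIntegral.integral_const_mul, add_sub_cancel_left, one_smul] at hn2
    have h5 : 2 / ε * ∫ t in x..x + 1, ‖g t‖ ^ 2 < 2 / ε * (ε / 4) ^ 2 := by gcongr
    have h6 : 2 / ε * (ε / 4) ^ 2 = ε / 8 := by field_simp; norm_num
    rw [Real.dist_eq]
    have h7 : |‖U y‖ - ‖U x‖| ≤ ‖U y - U x‖ := abs_norm_sub_norm_le _ _
    rw [abs_lt] at hy3 ⊢
    rw [abs_le] at h7
    constructor <;> linarith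
  simpa using key.pow 2

/-- The flux map multiplies the component along `z` by `1 - 2κ|z|²` and fixes the orthogonal one, so
it is inverted by a rank-one correction. -/
theorem velocity_flux {κ : ℝ} {z w : ℂ} (hd : 1 - 2 * κ * ‖z‖ ^ 2 ≠ 0) :
    velocity κ z (w - (2 * κ * inner ℝ z w) • z) = w := by
  have h1 : inner ℝ z (w - (2 * κ * inner ℝ z w) • z)
      = inner ℝ z w * (1 - 2 * κ * ‖z‖ ^ 2) := by
    rw [inner_sub_right, real_inner_smul_right, real_inner_self_eq_norm_sq]; ring
  rw [velocity, h1, mul_div_assoc, mul_div_cancel_right₀ _ hd, sub_add_cancel]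

theorem inner_velocity {κ : ℝ} {z f : ℂ} (hd : 1 - 2 * κ * ‖z‖ ^ 2 ≠ 0) :
    inner ℝ z (velocity κ z f) = inner ℝ z f / (1 - 2 * κ * ‖z‖ ^ 2) := by
  rw [velocity, inner_add_right, real_inner_smul_right, real_inner_self_eq_norm_sq]
  field_simp; ring

theorem inner_I_mul_velocity (κ : ℝ) (z f : ℂ) :
    inner ℝ (Complex.I * z) (velocity κ z f) = inner ℝ (Complex.I * z) f := by
  rw [velocity, inner_add_right, real_inner_smul_right]
  have : inner ℝ (Complex.I * z) z = 0 := by simp [Complex.inner]; ring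
  rw [this]; ring

/-- A nonzero constant is not integrable on a half-line. The separate threshold `b'` leaves room for
bounds valid only far out. -/
theorem eq_zero_of_deriv_zero_of_le_integrable {f h : ℝ → ℝ} {b b' : ℝ}
    (hf : ∀ x, b < x → HasDerivAt f 0 x) (hh : Integrable h volume)
    (hle : ∀ᵐ x, b' < x → |f x| ≤ h x) : ∀ x, b < x → f x = 0 := by
  obtain ⟨K, hK⟩ := isOpen_Ioi.exists_is_const_of_deriv_eq_zero (isPreconnected_Ioi (a := b))
    (f := f) (fun x hx => (hf x hx).differentiableAt.differentiableWithinAt)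
    (fun x hx => (hf x hx).deriv)
  have hi : IntegrableOn (fun _ : ℝ => K) (Ioi (max b b')) volume := by
    refine Integrable.mono' (hh.integrableOn (s := Ioi (max b b')))
      aestronglyMeasurable_const ?_
    refine (ae_restrict_iff' measurableSet_Ioi).2 ?_
    filter_upwards [hle] with x hx hxb
    rw [← hK x ((le_max_left b b').trans_lt hxb : b < x)]
    exact hx ((le_max_right _ _).trans_lt hxb)
  have hK0 : K = 0 := by
    rcases (integrableOn_const_iff (by simp)).1 hi with h | h
    · simpa using h
    · simp at h
  intro x hx
  rw [hK x hx, hK0]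

/-! ### Regularity away from degeneracy, and first integrals -/

namespace WeakProfile

variable {c κ : ℝ} {U F g : ℝ → ℂ}

theorem ae_velocity (h : WeakProfile c κ U F g) :
    ∀ᵐ x, 1 - 2 * κ * ‖U x‖ ^ 2 ≠ 0 → g x = velocity κ (U x) (F x) := by
  filter_upwards [h.flux_eq] with x hx hd
  rw [hx, velocity_flux hd]

theorem continuousAt_velocity (h : WeakProfile c κ U F g) {x : ℝ}
    (hx : 1 - 2 * κ * ‖U x‖ ^ 2 ≠ 0) : ContinuousAt (fun y => velocity κ (U y) (F y)) x := by
  have h1 := h.continuous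
  have h2 := h.continuous_flux
  unfold velocity
  have h3 : ContinuousAt (fun y => 2 * κ * inner ℝ (U y) (F y)) x :=
    (continuous_const.mul (h1.inner h2)).continuousAt
  have h4 : ContinuousAt (fun y => 1 - 2 * κ * ‖U y‖ ^ 2) x :=
    (by fun_prop : Continuous fun y => 1 - 2 * κ * ‖U y‖ ^ 2).continuousAt
  exact h2.continuousAt.add ((h3.div h4 hx).smul h1.continuousAt)

theorem eventually_ne (h : WeakProfile c κ U F g) {x : ℝ} (hx : 1 - 2 * κ * ‖U x‖ ^ 2 ≠ 0) :
    ∀ᶠ y in 𝓝 x, 1 - 2 * κ * ‖U y‖ ^ 2 ≠ 0 := by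
  have h1 := h.continuous
  exact (by fun_prop : Continuous fun y => 1 - 2 * κ * ‖U y‖ ^ 2).continuousAt.eventually_ne hx

/-- Near a nondegenerate point `g` agrees almost everywhere with a function continuous there, so its
primitive is classically differentiable at that point. -/
theorem hasDerivAt (h : WeakProfile c κ U F g) {x : ℝ} (hx : 1 - 2 * κ * ‖U x‖ ^ 2 ≠ 0) :
    HasDerivAt U (velocity κ (U x) (F x)) x := by
  suffices hs : HasDerivAt (fun y => U 0 + ∫ t in (0 : ℝ)..y, g t) (velocity κ (U x) (F x)) x from
    hs.congr_of_eventuallyEq (Eventually.of_forall h.eq_primitive)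
  refine HasDerivAt.const_add _ (intervalIntegral.integral_hasDerivAt_of_tendsto_ae_right
    (h.intervalIntegrable _ _)
    (h.memLp.1.stronglyMeasurableAtFilter) ?_)
  refine (((h.continuousAt_velocity hx).mono_left inf_le_left).congr' ?_)
  filter_upwards [(h.eventually_ne hx).filter_mono inf_le_left,
    h.ae_velocity.filter_mono inf_le_right] with y h1 h2
  exact (h2 h1).symm

theorem continuousAt_source (h : WeakProfile c κ U F g) {x : ℝ}
    (hx : 1 - 2 * κ * ‖U x‖ ^ 2 ≠ 0) :
    ContinuousAt (fun y => source c κ (U y) (velocity κ (U y) (F y))) x := by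
  have h1 := h.continuous.continuousAt (x := x)
  have h2 := h.continuousAt_velocity hx
  unfold source
  have h3 : ContinuousAt (fun y => inner ℝ (U y) (velocity κ (U y) (F y))) x := h1.inner h2
  have h4 : ContinuousAt (fun y => ((1 - ‖U y‖ ^ 2 : ℝ) : ℂ)) x := by
    have := h.continuous
    exact (by fun_prop : Continuous (fun y => ((1 - ‖U y‖ ^ 2 : ℝ) : ℂ))).continuousAt
  exact (((continuousAt_const.mul h2).add (h1.mul h4)).add
    ((continuousAt_const.mul h3).smul h2)).neg

theorem hasDerivAt_flux (h : WeakProfile c κ U F g) {x : ℝ} (hx : 1 - 2 * κ * ‖U x‖ ^ 2 ≠ 0) :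
    HasDerivAt F (source c κ (U x) (velocity κ (U x) (F x))) x := by
  suffices hs : HasDerivAt (fun y => F 0 + ∫ t in (0 : ℝ)..y, source c κ (U t) (g t))
      (source c κ (U x) (velocity κ (U x) (F x))) x from
    hs.congr_of_eventuallyEq (Eventually.of_forall h.flux_eq_primitive)
  refine HasDerivAt.const_add _ (intervalIntegral.integral_hasDerivAt_of_tendsto_ae_right
    (h.intervalIntegrable_source _ _)
    (h.locallyIntegrable_source.aestronglyMeasurable.stronglyMeasurableAtFilter) ?_)
  refine (((h.continuousAt_source hx).mono_left inf_le_left).congr' ?_)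
  filter_upwards [(h.eventually_ne hx).filter_mono inf_le_left,
    h.ae_velocity.filter_mono inf_le_right] with y h1 h2
  rw [h2 h1]

theorem hasDerivAt_norm_sq (h : WeakProfile c κ U F g) {x : ℝ}
    (hx : 1 - 2 * κ * ‖U x‖ ^ 2 ≠ 0) :
    HasDerivAt (fun y => ‖U y‖ ^ 2) (2 * inner ℝ (U x) (velocity κ (U x) (F x))) x :=
  (h.hasDerivAt hx).norm_sq

/-- `⟨U, F⟩` is `(1 - 2κ|U|²)⟨U, U'⟩`, a multiple of `η'`. Differentiating it instead of `η'`
requires no second derivative of `U`. -/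
theorem hasDerivAt_radial (h : WeakProfile c κ U F g) {x : ℝ}
    (hx : 1 - 2 * κ * ‖U x‖ ^ 2 ≠ 0) :
    HasDerivAt (fun y => inner ℝ (U y) (F y))
      (‖velocity κ (U x) (F x)‖ ^ 2 - 4 * κ * (inner ℝ (U x) (velocity κ (U x) (F x))) ^ 2
        + c * inner ℝ (Complex.I * U x) (velocity κ (U x) (F x))
        - ‖U x‖ ^ 2 * (1 - ‖U x‖ ^ 2)) x := by
  have h1 := (h.hasDerivAt hx).inner ℝ (h.hasDerivAt_flux hx)
  have hF : F x = velocity κ (U x) (F x)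
      - (2 * κ * inner ℝ (U x) (velocity κ (U x) (F x))) • U x := by
    rw [inner_velocity hx, velocity, mul_div_assoc, add_sub_cancel_right]
  refine h1.congr_deriv ?_
  set V := velocity κ (U x) (F x)
  rw [hF]
  rw [inner_sub_right, real_inner_smul_right, real_inner_self_eq_norm_sq]
  simp only [source, Complex.inner, Complex.mul_re, Complex.mul_im, Complex.conj_re,
          Complex.conj_im, Complex.smul_re, Complex.smul_im, Complex.neg_re, Complex.neg_im,
          Complex.add_re, Complex.add_im, Complex.I_re,
          Complex.I_im, Complex.ofReal_re, Complex.ofReal_im, smul_eq_mul, Complex.sq_norm,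
          Complex.normSq_apply]
  ring

/-- The term `-i c U'` of `F'` contributes `-c⟨U, U'⟩` to the derivative of `⟨iU, F⟩`, which is the
derivative of `c/2 (1 - |U|²)`; the other terms cancel. -/
theorem hasDerivAt_angular (h : WeakProfile c κ U F g) {x : ℝ}
    (hx : 1 - 2 * κ * ‖U x‖ ^ 2 ≠ 0) :
    HasDerivAt (fun y => inner ℝ (Complex.I * U y) (F y) - c / 2 * (1 - ‖U y‖ ^ 2)) 0 x := by
  have h1 := (((h.hasDerivAt hx).const_mul Complex.I).inner ℝ (h.hasDerivAt_flux hx)).sub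
    (((h.hasDerivAt_norm_sq hx).const_sub 1).const_mul (c / 2))
  have hF : F x = velocity κ (U x) (F x)
      - (2 * κ * inner ℝ (U x) (velocity κ (U x) (F x))) • U x := by
    rw [inner_velocity hx, velocity, mul_div_assoc, add_sub_cancel_right]
  refine h1.congr_deriv ?_
  set V := velocity κ (U x) (F x)
  rw [hF]
  simp only [source, Complex.inner, Complex.mul_re, Complex.mul_im, Complex.conj_re,
          Complex.conj_im, Complex.smul_re, Complex.smul_im, Complex.neg_re, Complex.neg_im,
          Complex.add_re, Complex.add_im, Complex.sub_re, Complex.sub_im, Complex.I_re,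
          Complex.I_im, Complex.ofReal_re, Complex.ofReal_im, smul_eq_mul, Complex.sq_norm,
          Complex.normSq_apply]
  ring

/-- This is `|U'|² - 2κ⟨U, U'⟩² - (1 - |U|²)²/2` rewritten through the flux, whose derivative is
known. -/
theorem hasDerivAt_energy (h : WeakProfile c κ U F g) {x : ℝ}
    (hx : 1 - 2 * κ * ‖U x‖ ^ 2 ≠ 0) :
    HasDerivAt (fun y => ‖F y‖ ^ 2
      + 2 * κ * (inner ℝ (U y) (F y) ^ 2 / (1 - 2 * κ * ‖U y‖ ^ 2))
      - (1 - ‖U y‖ ^ 2) ^ 2 / 2) 0 x := by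
  have hm := h.hasDerivAt_radial hx
  have hρ := h.hasDerivAt_norm_sq hx
  have h1 := (((h.hasDerivAt_flux hx).norm_sq).add
    (((hm.pow 2).div ((hρ.const_mul (2 * κ)).const_sub 1) hx).const_mul (2 * κ))).sub
    (((hρ.const_sub 1).pow 2).div_const 2)
  have hF : F x = velocity κ (U x) (F x)
      - (2 * κ * inner ℝ (U x) (velocity κ (U x) (F x))) • U x := by
    rw [inner_velocity hx, velocity, mul_div_assoc, add_sub_cancel_right]
  have hm' : inner ℝ (U x) (F x)
      = inner ℝ (U x) (velocity κ (U x) (F x)) * (1 - 2 * κ * ‖U x‖ ^ 2) := by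
    rw [inner_velocity hx, div_mul_cancel₀ _ hx]
  refine h1.congr_deriv ?_
  change 2 * inner ℝ (F x) (source c κ (U x) (velocity κ (U x) (F x))) + 2 * κ *
    (((2 : ℕ) * inner ℝ (U x) (F x) ^ (2 - 1) * _ * _ - inner ℝ (U x) (F x) ^ 2 * _) / _) - _ = _
  rw [hm']
  set V := velocity κ (U x) (F x)
  rw [hF]
  set d := 1 - 2 * κ * ‖U x‖ ^ 2 with hd
  have e : ∀ A σ K : ℝ, ((2 : ℕ) * (σ * d) ^ (2 - 1) * A * d - (σ * d) ^ 2 * K) / d ^ 2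
      = 2 * σ * A - σ ^ 2 * K := by
    intro A σ K
    field_simp
    norm_num
    ring
  rw [e]
  simp only [source, Complex.inner, Complex.mul_re, Complex.mul_im, Complex.conj_re,
          Complex.conj_im, Complex.smul_re, Complex.smul_im, Complex.neg_re, Complex.neg_im,
          Complex.add_re, Complex.add_im, Complex.sub_re, Complex.sub_im, Complex.I_re,
          Complex.I_im, Complex.ofReal_re, Complex.ofReal_im, smul_eq_mul, Complex.sq_norm,
          Complex.normSq_apply]
  push_cast
  ring

theorem eventually_norm_sq_le_two (h : WeakProfile c κ U F g) :
    ∃ b, ∀ x, b < x → ‖U x‖ ^ 2 ≤ 2 := by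
  have := (h.tendsto_norm_sq fun _ => tendsto_window_atTop).eventually
    (ge_mem_nhds (one_lt_two))
  obtain ⟨b, hb⟩ := eventually_atTop.1 this
  exact ⟨b, fun x hx => hb x hx.le⟩

/-- First integral: the angular momentum. -/
theorem angular_eq (h : WeakProfile c κ U F g) {b : ℝ}
    (hb : ∀ x, b < x → 1 - 2 * κ * ‖U x‖ ^ 2 ≠ 0) {x : ℝ} (hx : b < x) :
    inner ℝ (Complex.I * U x) (velocity κ (U x) (F x)) = c / 2 * (1 - ‖U x‖ ^ 2) := by
  obtain ⟨b', hb'⟩ := h.eventually_norm_sq_le_two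
  -- The conserved quantity is squared because only `|g|²` and `(1 - |U|²)²` are known to be
  -- integrable.
  have key := eq_zero_of_deriv_zero_of_le_integrable (b := b) (b' := max b b')
    (f := fun x => (inner ℝ (Complex.I * U x) (F x) - c / 2 * (1 - ‖U x‖ ^ 2)) ^ 2)
    (h := fun x => 4 * ‖g x‖ ^ 2 + c ^ 2 / 2 * (1 - ‖U x‖ ^ 2) ^ 2)
    (fun x hx => ((h.hasDerivAt_angular (hb x hx)).pow 2).congr_deriv (by simp))
    (((h.memLp.integrable_norm_pow two_ne_zero).const_mul 4).add (h.integrable_sq.const_mul _))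
    (by
      filter_upwards [h.ae_velocity] with x hx hxb
      have hx1 := hb x ((le_max_left _ _).trans_lt hxb)
      have hx2 := hb' x ((le_max_right _ _).trans_lt hxb)
      rw [← inner_I_mul_velocity κ, ← hx hx1, abs_of_nonneg (sq_nonneg _)]
      have h1 : inner ℝ (Complex.I * U x) (g x) ^ 2 ≤ 2 * ‖g x‖ ^ 2 := by
        have h2 := abs_real_inner_le_norm (Complex.I * U x) (g x)
        rw [norm_mul, Complex.norm_I, one_mul] at h2
        have h3 := pow_le_pow_left₀ (abs_nonneg _) h2 2
        rw [sq_abs, mul_pow] at h3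
        exact h3.trans (by gcongr)
      nlinarith [sq_nonneg (inner ℝ (Complex.I * U x) (g x) + c / 2 * (1 - ‖U x‖ ^ 2))])
    x hx
  rw [inner_I_mul_velocity]
  exact sub_eq_zero.1 (pow_eq_zero_iff two_ne_zero |>.1 key)

/-- First integral: the energy. -/
theorem energy_eq (h : WeakProfile c κ U F g) {b : ℝ}
    (hb : ∀ x, b < x → 1 - 2 * κ * ‖U x‖ ^ 2 ≠ 0) {x : ℝ} (hx : b < x) :
    ‖velocity κ (U x) (F x)‖ ^ 2 = 2 * κ * inner ℝ (U x) (velocity κ (U x) (F x)) ^ 2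
      + (1 - ‖U x‖ ^ 2) ^ 2 / 2 := by
  obtain ⟨b', hb'⟩ := h.eventually_norm_sq_le_two
  have hval (x : ℝ) (hx : b < x) : ‖F x‖ ^ 2
      + 2 * κ * (inner ℝ (U x) (F x) ^ 2 / (1 - 2 * κ * ‖U x‖ ^ 2))
      - (1 - ‖U x‖ ^ 2) ^ 2 / 2 = ‖velocity κ (U x) (F x)‖ ^ 2
      - 2 * κ * inner ℝ (U x) (velocity κ (U x) (F x)) ^ 2 - (1 - ‖U x‖ ^ 2) ^ 2 / 2 := by
    have hx := hb x hx
    rw [inner_velocity hx, velocity, norm_add_sq_real, norm_smul, real_inner_smul_right,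
      real_inner_comm (U x) (F x), mul_pow, Real.norm_eq_abs, sq_abs]
    field_simp
    ring
  have key := eq_zero_of_deriv_zero_of_le_integrable (b := b) (b' := max b b')
    (f := fun x => ‖F x‖ ^ 2
      + 2 * κ * (inner ℝ (U x) (F x) ^ 2 / (1 - 2 * κ * ‖U x‖ ^ 2))
      - (1 - ‖U x‖ ^ 2) ^ 2 / 2)
    (h := fun x => (1 + 4 * |κ|) * ‖g x‖ ^ 2 + 1 / 2 * (1 - ‖U x‖ ^ 2) ^ 2)
    (fun x hx => h.hasDerivAt_energy (hb x hx))
    (((h.memLp.integrable_norm_pow two_ne_zero).const_mul _).add (h.integrable_sq.const_mul _))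
    (by
      filter_upwards [h.ae_velocity] with x hx hxb
      have hx1 := hb x ((le_max_left _ _).trans_lt hxb)
      have hx2 := hb' x ((le_max_right _ _).trans_lt hxb)
      rw [hval x ((le_max_left _ _).trans_lt hxb), ← hx hx1]
      have h1 : inner ℝ (U x) (g x) ^ 2 ≤ 2 * ‖g x‖ ^ 2 := by
        have h2 := abs_real_inner_le_norm (U x) (g x)
        have h3 := pow_le_pow_left₀ (abs_nonneg _) h2 2
        rw [sq_abs, mul_pow] at h3
        exact h3.trans (by gcongr)
      have h2 : |κ * inner ℝ (U x) (g x) ^ 2| ≤ |κ| * (2 * ‖g x‖ ^ 2) := by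
        rw [abs_mul, abs_of_nonneg (sq_nonneg (inner ℝ (U x) (g x)))]
        gcongr
      rw [abs_le] at h2 ⊢
      constructor <;> nlinarith [sq_nonneg (1 - ‖U x‖ ^ 2), sq_nonneg ‖g x‖])
    x hx
  rw [hval x hx] at key
  linarith

/-- The first-order equation satisfied by the intensity. -/
theorem intensity_eq (h : WeakProfile c κ U F g) {b : ℝ}
    (hb : ∀ x, b < x → 1 - 2 * κ * ‖U x‖ ^ 2 ≠ 0) {x : ℝ} (hx : b < x) :
    4 * inner ℝ (U x) (velocity κ (U x) (F x)) ^ 2 * (1 - 2 * κ * ‖U x‖ ^ 2)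
      = (1 - ‖U x‖ ^ 2) ^ 2 * (2 * ‖U x‖ ^ 2 - c ^ 2) := by
  have hJ := h.angular_eq hb hx
  have hE := h.energy_eq hb hx
  set V := velocity κ (U x) (F x)
  -- Lagrange's identity in the orthogonal frame `U`, `iU`.
  have hL : inner ℝ (U x) V ^ 2 + inner ℝ (Complex.I * U x) V ^ 2 = ‖U x‖ ^ 2 * ‖V‖ ^ 2 := by
    simp only [Complex.inner, Complex.mul_re, Complex.mul_im, Complex.conj_re,
          Complex.conj_im, Complex.I_re, Complex.I_im, Complex.sq_norm, Complex.normSq_apply]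
    ring
  rw [hJ, hE] at hL
  linear_combination 4 * hL

end WeakProfile

/-! ### The function `G`, with `κ = -k ^ 2` -/

theorem hasDerivAt_artanh {x : ℝ} (h1 : -1 < x) (h2 : x < 1) :
    HasDerivAt Real.artanh (1 / (1 - x ^ 2)) x := by
  have hd : HasDerivAt (fun y : ℝ => 1 / 2 * (Real.log (1 + y) - Real.log (1 - y)))
      (1 / 2 * (1 / (1 + x) - (-1) / (1 - x))) x :=
    ((((hasDerivAt_id x).const_add 1).log (by simp; linarith)).sub
      (((hasDerivAt_id x).const_sub 1).log (by simp; linarith))).const_mul _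
  have hval : 1 / 2 * (1 / (1 + x) - (-1) / (1 - x)) = 1 / (1 - x ^ 2) := by
    have : 1 + x ≠ 0 := by linarith
    have : 1 - x ≠ 0 := by linarith
    have : 1 - x ^ 2 ≠ 0 := by nlinarith
    field_simp
    ring
  rw [← hval]
  refine hd.congr_of_eventuallyEq ?_
  filter_upwards [Ioo_mem_nhds h1 h2] with y hy
  rw [Real.artanh_eq_half_log ⟨hy.1.le, hy.2.le⟩, Real.log_div (by linarith [hy.1])
    (by linarith [hy.2])]

section Implicit

variable {c k y : ℝ}

/-- The quotient under the square roots in `G`. -/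
noncomputable def ratio (c k y : ℝ) : ℝ := (2 - c ^ 2 - 2 * y) / (1 + 2 * k ^ 2 - 2 * k ^ 2 * y)

theorem ratio_den_pos (hy : y ≤ 1 - c ^ 2 / 2) : 0 < 1 + 2 * k ^ 2 - 2 * k ^ 2 * y := by
  nlinarith [mul_nonneg (sq_nonneg k) (by nlinarith [sq_nonneg c] : 0 ≤ 1 - y)]

theorem ratio_nonneg (hy : y ≤ 1 - c ^ 2 / 2) : 0 ≤ ratio c k y :=
  div_nonneg (by linarith) (ratio_den_pos hy).le

theorem one_sub_sq_mul_ratio (hy : y ≤ 1 - c ^ 2 / 2) :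
    1 - k ^ 2 * ratio c k y = (1 + k ^ 2 * c ^ 2) / (1 + 2 * k ^ 2 - 2 * k ^ 2 * y) := by
  have := (ratio_den_pos (k := k) hy).ne'
  rw [ratio, mul_div_assoc', eq_div_iff this, sub_mul, div_mul_cancel₀ _ this]
  ring

theorem one_sub_mul_ratio (hc : c ^ 2 < 2) (hy : y ≤ 1 - c ^ 2 / 2) :
    1 - (1 + 2 * k ^ 2) / (2 - c ^ 2) * ratio c k y
      = 2 * y * (1 + k ^ 2 * c ^ 2) / ((2 - c ^ 2) * (1 + 2 * k ^ 2 - 2 * k ^ 2 * y)) := by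
  have := (ratio_den_pos (k := k) hy).ne'
  have : 2 - c ^ 2 ≠ 0 := by linarith
  rw [ratio]
  field_simp
  ring

theorem G_eq_artanh (hk : 0 ≤ k) (hc : c ^ 2 < 2) (y : ℝ) :
    G c (-k ^ 2) y = -2 * k * Real.artanh (k * √(ratio c k y))
      + 2 * √((1 + 2 * k ^ 2) / (2 - c ^ 2))
        * Real.artanh (√((1 + 2 * k ^ 2) / (2 - c ^ 2)) * √(ratio c k y)) := by
  have h1 : √(- -k ^ 2) = k := by rw [neg_neg, Real.sqrt_sq hk]
  have h2 : 0 ≤ (1 + 2 * k ^ 2) / (2 - c ^ 2) := div_nonneg (by positivity) (by linarith)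
  rw [G, h1, ← Real.sqrt_mul h2, ratio, div_mul_div_comm]
  congr 3 <;> ring_nf

theorem mul_sqrt_ratio_lt_one (hy : y ≤ 1 - c ^ 2 / 2) :
    k * √(ratio c k y) < 1 := by
  have h := one_sub_sq_mul_ratio (k := k) hy
  have h1 : 0 < (1 + k ^ 2 * c ^ 2) / (1 + 2 * k ^ 2 - 2 * k ^ 2 * y) :=
    div_pos (by positivity) (ratio_den_pos hy)
  rw [← h] at h1
  refine lt_of_pow_lt_pow_left₀ 2 zero_le_one ?_
  rw [mul_pow, Real.sq_sqrt (ratio_nonneg hy)]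
  linarith

theorem sqrt_mul_sqrt_ratio_lt_one (hc : c ^ 2 < 2) (hy0 : 0 < y) (hy : y ≤ 1 - c ^ 2 / 2) :
    √((1 + 2 * k ^ 2) / (2 - c ^ 2)) * √(ratio c k y) < 1 := by
  have h := one_sub_mul_ratio (k := k) hc hy
  have h1 : 0 < 2 * y * (1 + k ^ 2 * c ^ 2)
      / ((2 - c ^ 2) * (1 + 2 * k ^ 2 - 2 * k ^ 2 * y)) :=
    div_pos (by positivity) (mul_pos (by linarith) (ratio_den_pos hy))
  rw [← h] at h1
  refine lt_of_pow_lt_pow_left₀ 2 zero_le_one ?_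
  rw [mul_pow, Real.sq_sqrt (ratio_nonneg hy),
    Real.sq_sqrt (div_nonneg (by positivity) (by linarith))]
  linarith

theorem hasDerivAt_ratio (hy : y ≤ 1 - c ^ 2 / 2) :
    HasDerivAt (ratio c k) (-2 * (1 + k ^ 2 * c ^ 2) / (1 + 2 * k ^ 2 - 2 * k ^ 2 * y) ^ 2) y := by
  have h := (((hasDerivAt_id y).const_mul 2).const_sub (2 - c ^ 2)).div
    (((hasDerivAt_id y).const_mul (2 * k ^ 2)).const_sub (1 + 2 * k ^ 2)) (ratio_den_pos hy).ne'
  refine h.congr_deriv ?_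
  simp only [id]
  congr 1
  ring

theorem continuousOn_G (hk : 0 ≤ k) (hc : c ^ 2 < 2) : ContinuousOn (G c (-k ^ 2)) (Ic c) := by
  rw [funext (G_eq_artanh hk hc)]
  intro y hy
  have hr : ContinuousAt (fun y => √(ratio c k y)) y :=
    (hasDerivAt_ratio hy.2).continuousAt.sqrt
  have h0 := Real.sqrt_nonneg (ratio c k y)
  have h1 : ContinuousAt Real.artanh (k * √(ratio c k y)) :=
    (hasDerivAt_artanh (by nlinarith [mul_nonneg hk h0])
      (mul_sqrt_ratio_lt_one hy.2)).continuousAt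
  have h2 : ContinuousAt Real.artanh (√((1 + 2 * k ^ 2) / (2 - c ^ 2)) * √(ratio c k y)) :=
    (hasDerivAt_artanh (by nlinarith [mul_nonneg (Real.sqrt_nonneg
      ((1 + 2 * k ^ 2) / (2 - c ^ 2))) h0])
      (sqrt_mul_sqrt_ratio_lt_one hc hy.1 hy.2)).continuousAt
  have h3 : ContinuousAt (fun y => Real.artanh (k * √(ratio c k y))) y :=
    ContinuousAt.comp (f := fun y => k * √(ratio c k y)) h1 (continuousAt_const.mul hr)
  have h4 : ContinuousAt
      (fun y => Real.artanh (√((1 + 2 * k ^ 2) / (2 - c ^ 2)) * √(ratio c k y))) y :=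
    ContinuousAt.comp (f := fun y => √((1 + 2 * k ^ 2) / (2 - c ^ 2)) * √(ratio c k y)) h2
      (continuousAt_const.mul hr)
  exact ((continuousAt_const.mul h3).add (continuousAt_const.mul h4)).continuousWithinAt

/-- Separation of variables: decreasing profiles satisfy `η' = -η √(ratio c k η)`, and `G`
integrates `dη / η'`. The right endpoint is excluded because `ratio` vanishes there. -/
theorem hasDerivAt_G (hk : 0 ≤ k) (hc : c ^ 2 < 2) (hy0 : 0 < y) (hy : y < 1 - c ^ 2 / 2) :
    HasDerivAt (G c (-k ^ 2)) (-1 / (y * √(ratio c k y))) y := by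
  rw [funext (G_eq_artanh hk hc)]
  have hD := ratio_den_pos (k := k) hy.le
  have hR : 0 < ratio c k y := div_pos (by linarith) hD
  have hs : HasDerivAt (fun y => √(ratio c k y)) _ y := (hasDerivAt_ratio hy.le).sqrt hR.ne'
  have h0 := Real.sqrt_pos.2 hR
  have hm0 : 0 < (1 + 2 * k ^ 2) / (2 - c ^ 2) := div_pos (by positivity) (by linarith)
  have hm := Real.sqrt_pos.2 hm0
  have h1 := (hasDerivAt_artanh (by nlinarith [mul_nonneg hk h0.le])
      (mul_sqrt_ratio_lt_one hy.le)).comp y (hs.const_mul k)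
  have h2 := (hasDerivAt_artanh (by nlinarith [mul_pos hm h0])
      (sqrt_mul_sqrt_ratio_lt_one hc hy0 hy.le)).comp y (hs.const_mul _)
  have h := (h1.const_mul (-2 * k)).add (h2.const_mul (2 * √((1 + 2 * k ^ 2) / (2 - c ^ 2))))
  refine h.congr_deriv ?_
  have e1 : 1 - (k * √(ratio c k y)) ^ 2
      = (1 + k ^ 2 * c ^ 2) / (1 + 2 * k ^ 2 - 2 * k ^ 2 * y) := by
    rw [mul_pow, Real.sq_sqrt hR.le, one_sub_sq_mul_ratio hy.le]
  have e2 : 1 - (√((1 + 2 * k ^ 2) / (2 - c ^ 2)) * √(ratio c k y)) ^ 2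
      = 2 * y * (1 + k ^ 2 * c ^ 2) / ((2 - c ^ 2) * (1 + 2 * k ^ 2 - 2 * k ^ 2 * y)) := by
    rw [mul_pow, Real.sq_sqrt hR.le, Real.sq_sqrt hm0.le, one_sub_mul_ratio hc hy.le]
  rw [e1, e2]
  have e3 := Real.sq_sqrt hm0.le
  generalize √((1 + 2 * k ^ 2) / (2 - c ^ 2)) = m at *
  generalize √(ratio c k y) = s at *
  have hA : 2 - c ^ 2 ≠ 0 := by linarith
  have hQ : 1 + k ^ 2 * c ^ 2 ≠ 0 := by positivity
  have e4 : m ^ 2 * (2 - c ^ 2) = 1 + 2 * k ^ 2 := by rw [e3]; field_simp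
  have hD' := hD.ne'
  generalize hDd : 1 + 2 * k ^ 2 - 2 * k ^ 2 * y = d at *
  field_simp
  linear_combination (-1 : ℝ) * e4 - hDd

theorem strictAntiOn_G (hk : 0 ≤ k) (hc : c ^ 2 < 2) : StrictAntiOn (G c (-k ^ 2)) (Ic c) := by
  refine strictAntiOn_of_deriv_neg (convex_Ioc _ _) (continuousOn_G hk hc) fun y hy => ?_
  rw [interior_Ioc] at hy
  rw [(hasDerivAt_G hk hc hy.1 hy.2).deriv]
  have : 0 < √(ratio c k y) :=
    Real.sqrt_pos.2 (div_pos (by linarith [hy.2]) (ratio_den_pos hy.2.le))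
  have := mul_pos hy.1 this
  exact div_neg_of_neg_of_pos (by norm_num) this

theorem G_right_end (hk : 0 ≤ k) (hc : c ^ 2 < 2) : G c (-k ^ 2) (1 - c ^ 2 / 2) = 0 := by
  have : ratio c k (1 - c ^ 2 / 2) = 0 := by rw [ratio]; ring_nf
  rw [G_eq_artanh hk hc, this]
  simp

end Implicit

/-! ### Half-profiles and inversion of `G` -/

/-- `e` is a half-profile: it decreases from the maximal intensity `1 - c²/2` according to the
first-order equation of the soliton. -/
structure HalfProfile (c κ : ℝ) (e e' : ℝ → ℝ) : Prop where
  continuous : Continuous e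
  zero : e 0 = 1 - c ^ 2 / 2
  pos : ∀ x, 0 < x → 0 < e x
  lt : ∀ x, 0 < x → e x < 1 - c ^ 2 / 2
  deriv : ∀ x, 0 < x → HasDerivAt e (e' x) x
  deriv_neg : ∀ x, 0 < x → e' x < 0
  eqn : ∀ x, 0 < x → e' x ^ 2 * (1 - 2 * κ + 2 * κ * e x) = e x ^ 2 * (2 - c ^ 2 - 2 * e x)

namespace HalfProfile

variable {c κ : ℝ} {e e' : ℝ → ℝ}

theorem mem_Ic (h : HalfProfile c κ e e') (hc : c ^ 2 < 2) {x : ℝ} (hx : 0 ≤ x) :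
    e x ∈ Ic c := by
  rcases hx.eq_or_lt with rfl | hx
  · rw [h.zero]
    exact ⟨by linarith, le_rfl⟩
  · exact ⟨h.pos x hx, (h.lt x hx).le⟩

/-- `G ∘ e` has derivative one for positive times and vanishes at `0`. The mean value theorem needs
only continuity at `0`, where the formula for `G'` is singular. -/
theorem G_eq (h : HalfProfile c κ e e') (hc : c ^ 2 < 2) (hκ : κ ≤ 0) {x : ℝ} (hx : 0 ≤ x) :
    G c κ (e x) = x := by
  obtain ⟨k, hk, rfl⟩ : ∃ k : ℝ, 0 ≤ k ∧ κ = -k ^ 2 :=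
    ⟨√(-κ), Real.sqrt_nonneg _, by rw [Real.sq_sqrt (by linarith)]; ring⟩
  rcases hx.eq_or_lt with rfl | hx
  · rw [h.zero, G_right_end hk hc]
  have hcont : ContinuousOn (fun t => G c (-k ^ 2) (e t)) (Icc 0 x) :=
    (continuousOn_G hk hc).comp h.continuous.continuousOn fun t ht => h.mem_Ic hc ht.1
  have hderiv (t : ℝ) (ht : t ∈ Ioo 0 x) : HasDerivAt (fun t => G c (-k ^ 2) (e t)) 1 t := by
    have h0 := h.pos t ht.1
    have h1 := h.lt t ht.1
    refine ((hasDerivAt_G hk hc h0 h1).comp t (h.deriv t ht.1)).congr_deriv ?_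
    have hD := ratio_den_pos (k := k) h1.le
    have hR : 0 < ratio c k (e t) := div_pos (by linarith) hD
    have hs := Real.sqrt_pos.2 hR
    have hsq : (-e' t) ^ 2 = (e t * √(ratio c k (e t))) ^ 2 := by
      rw [mul_pow, Real.sq_sqrt hR.le, ratio, mul_div_assoc', eq_div_iff hD.ne', ← h.eqn t ht.1]
      ring
    have := (pow_left_inj₀ (by linarith [h.deriv_neg t ht.1]) (by positivity) two_ne_zero).1 hsq
    have hne : e t * √(ratio c k (e t)) ≠ 0 := by positivity
    rw [div_mul_eq_mul_div, neg_one_mul, this, div_self hne]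
  obtain ⟨t, ht, he⟩ := exists_hasDerivAt_eq_slope _ _ hx hcont hderiv
  rw [h.zero, G_right_end hk hc, sub_zero, sub_zero, eq_comm, div_eq_one_iff_eq hx.ne'] at he
  exact he

/-- Surjectivity comes from the profile itself: `e x` is a preimage of `x`. -/
theorem bijOn (h : HalfProfile c κ e e') (hc : c ^ 2 < 2) (hκ : κ ≤ 0) :
    BijOn (G c κ) (Ic c) (Ici 0) := by
  obtain ⟨k, hk, rfl⟩ : ∃ k : ℝ, 0 ≤ k ∧ κ = -k ^ 2 :=
    ⟨√(-κ), Real.sqrt_nonneg _, by rw [Real.sq_sqrt (by linarith)]; ring⟩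
  refine ⟨fun y hy => ?_, (strictAntiOn_G hk hc).injOn, fun x hx => ⟨e x, h.mem_Ic hc hx,
    h.G_eq hc hκ hx⟩⟩
  rw [mem_Ici, ← G_right_end hk hc]
  exact (strictAntiOn_G hk hc).antitoneOn hy ⟨by linarith, le_rfl⟩ hy.2

theorem eta_eq (h : HalfProfile c κ e e') (hc : c ^ 2 < 2) (hκ : κ ≤ 0) (x : ℝ) :
    eta c κ x = e |x| := by
  rw [eta, ← h.G_eq hc hκ (abs_nonneg x)]
  rw [(h.bijOn hc hκ).injOn.leftInvOn_invFunOn (h.mem_Ic hc (abs_nonneg x)),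
    h.G_eq hc hκ (abs_nonneg x)]

end HalfProfile

/-- Zeros can only be crossed upwards, and a later zero would be a local minimum with nonzero
derivative. This makes the critical point of the intensity unique. -/
theorem pos_of_deriv_pos_at_zeros {f f' : ℝ → ℝ} (hf : ∀ x, HasDerivAt f (f' x) x)
    (hpos : ∀ x, f x = 0 → 0 < f' x) {x₀ : ℝ} (h0 : f x₀ = 0) {x : ℝ} (hx : x₀ < x) :
    0 < f x := by
  have hnn (y : ℝ) (hy : x₀ ≤ y) : 0 ≤ f y := by
    have := image_le_of_deriv_right_lt_deriv_boundary (f := fun t => -f t) (f' := fun t => -f' t)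
      (a := x₀) (b := y) (B := fun _ => 0) (B' := fun _ => 0)
      (fun t _ => (hf t).neg.continuousAt.continuousWithinAt)
      (fun t _ => (hf t).neg.hasDerivWithinAt) (by simp [h0]) (fun t => hasDerivAt_const _ _)
      (fun t _ ht => by simpa using hpos t (by simpa using ht)) (right_mem_Icc.2 hy)
    simpa using this
  refine (hnn x hx.le).lt_of_ne fun h => ?_
  have hmin : IsLocalMin f x := by
    filter_upwards [Ioi_mem_nhds hx] with y hy
    rw [← h]
    exact hnn y (le_of_lt hy)
  exact (hpos x h.symm).ne' (hmin.hasDerivAt_eq_zero (hf x))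

theorem neg_of_deriv_pos_at_zeros {f f' : ℝ → ℝ} (hf : ∀ x, HasDerivAt f (f' x) x)
    (hpos : ∀ x, f x = 0 → 0 < f' x) {x₀ : ℝ} (h0 : f x₀ = 0) {x : ℝ} (hx : x < x₀) :
    f x < 0 := by
  have h := pos_of_deriv_pos_at_zeros (f := fun t => -f (-t)) (f' := fun t => f' (-t))
    (fun t => ((hf (-t)).scomp t (hasDerivAt_neg t)).neg.congr_deriv (by simp))
    (fun t ht => hpos (-t) (by simpa using ht)) (x₀ := -x₀) (by simpa using h0) (x := -x)
    (by linarith)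
  simpa using h

/-- By Gronwall a zero would propagate to `x₀`; reflection handles the other direction. -/
theorem ne_zero_of_abs_deriv_le {f f' : ℝ → ℝ} {K : ℝ} (hf : ∀ x, HasDerivAt f (f' x) x)
    (hb : ∀ x, |f' x| ≤ K * |f x|) {x₀ : ℝ} (h0 : f x₀ ≠ 0) (x : ℝ) : f x ≠ 0 := by
  intro hx
  rcases le_total x x₀ with h | h
  · exact h0 (eq_zero_of_abs_deriv_le_mul_abs_self_of_eq_zero_right
      (fun t _ => (hf t).continuousAt.continuousWithinAt)
      (fun t _ => (hf t).hasDerivWithinAt) hx (fun t _ => hb t) x₀ (right_mem_Icc.2 h))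
  · have := eq_zero_of_abs_deriv_le_mul_abs_self_of_eq_zero_right
      (f := fun t => f (-t)) (f' := fun t => -f' (-t)) (K := K) (a := -x) (b := -x₀)
      (fun t _ => ((hf (-t)).continuousAt.comp continuousAt_neg).continuousWithinAt)
      (fun t _ =>
        (((hf (-t)).scomp t (hasDerivAt_neg t)).congr_deriv (by simp)).hasDerivWithinAt)
      (by simpa using hx) (fun t _ => by simpa using hb (-t)) (-x₀)
      (right_mem_Icc.2 (by linarith))
    exact h0 (by simpa using this)

/-! ### Constant solutions, smoothness, and shape of the intensity -/

namespace WeakProfile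

variable {c κ : ℝ} {U F g : ℝ → ℂ}

theorem eq_const_of_norm_sq_eq_one (h : WeakProfile c κ U F g) (hκ : κ ≠ 1 / 2)
    (h1 : ∀ x, ‖U x‖ ^ 2 = 1) : ∃ z : ℂ, ‖z‖ = 1 ∧ ∀ x, U x = z := by
  have hd (x : ℝ) : 1 - 2 * κ * ‖U x‖ ^ 2 ≠ 0 := by
    rw [h1]
    intro h
    exact hκ (by linarith)
  have hV (x : ℝ) : HasDerivAt U 0 x := by
    -- Since no point is degenerate, any half-line containing `x` serves.
    have e1 := h.energy_eq (b := x - 1) (fun y _ => hd y) (by linarith : x - 1 < x)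
    have e2 := (h.hasDerivAt_norm_sq (hd x)).unique
      ((hasDerivAt_const x (1 : ℝ)).congr_of_eventuallyEq (Eventually.of_forall h1))
    have e3 : inner ℝ (U x) (velocity κ (U x) (F x)) = 0 := by linarith
    rw [e3, h1] at e1
    have e4 : velocity κ (U x) (F x) = 0 := by
      rw [← norm_eq_zero]
      exact pow_eq_zero_iff two_ne_zero |>.1 (by rw [e1]; norm_num)
    exact e4 ▸ h.hasDerivAt (hd x)
  refine ⟨U 0, ?_, fun x => is_const_of_deriv_eq_zero (fun x => (hV x).differentiableAt)
    (fun x => (hV x).deriv) x 0⟩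
  exact (pow_eq_one_iff_of_nonneg (norm_nonneg _) two_ne_zero).1 (h1 0)

/-- If the far field is not hyperbolic, the intensity vanishes near infinity, hence everywhere. -/
theorem norm_sq_eq_one_of_neg (h : WeakProfile c κ U F g)
    (hneg : (1 - 2 * κ) * (2 - c ^ 2) < 0) (x : ℝ) : ‖U x‖ ^ 2 = 1 := by
  have hUc := h.continuous
  set N : ℝ → ℝ := fun x => (1 - 2 * κ * ‖U x‖ ^ 2) * (2 * ‖U x‖ ^ 2 - c ^ 2) with hN
  have hNc : Continuous N := by fun_prop
  set S : Set ℝ := {x | ∀ y, x < y → N y < 0}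
  have hS1 (a : ℝ) (ha : a ∈ S) (y : ℝ) (hy : a < y) : ‖U y‖ ^ 2 = 1 := by
    have hd (z : ℝ) (hz : a < z) : 1 - 2 * κ * ‖U z‖ ^ 2 ≠ 0 := fun h0 => by
      have := ha z hz
      simp only [hN, h0, zero_mul, lt_irrefl] at this
    have h1 := h.intensity_eq hd hy
    -- Multiplying the intensity equation by `1 - 2κ|U|²` makes one side a square, so `N < 0` forces
    -- `|U| = 1`.
    have h2 : (1 - ‖U y‖ ^ 2) ^ 2 * N y = (2 * inner ℝ (U y) (velocity κ (U y) (F y))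
        * (1 - 2 * κ * ‖U y‖ ^ 2)) ^ 2 := by
      simp only [hN]
      linear_combination -(1 - 2 * κ * ‖U y‖ ^ 2) * h1
    have h3 : (1 - ‖U y‖ ^ 2) ^ 2 = 0 := by
      have h4 := sq_nonneg (2 * inner ℝ (U y) (velocity κ (U y) (F y))
        * (1 - 2 * κ * ‖U y‖ ^ 2))
      rw [← h2] at h4
      have := ha y hy
      nlinarith [sq_nonneg (1 - ‖U y‖ ^ 2)]
    have := pow_eq_zero_iff two_ne_zero |>.1 h3
    linarith
  have hne : S.Nonempty := by
    have h1 : Tendsto N atTop (𝓝 ((1 - 2 * κ * 1) * (2 * 1 - c ^ 2))) := by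
      have := h.tendsto_norm_sq fun _ => tendsto_window_atTop
      exact (tendsto_const_nhds.sub (this.const_mul _)).mul
        ((this.const_mul 2).sub tendsto_const_nhds)
    obtain ⟨b, hb⟩ := eventually_atTop.1 (h1.eventually (gt_mem_nhds
      (by simpa using hneg : (1 - 2 * κ * 1) * (2 * 1 - c ^ 2) < 0)))
    exact ⟨b, fun y hy => hb y hy.le⟩
  -- Continuation to the left: at a finite infimum `|U| = 1` by closure, so `N` equals `(1 - 2κ)(2 -
  -- c²) < 0` there and stays negative slightly further left.
  by_cases hbdd : BddBelow S
  · exfalso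
    have hmem : sInf S ∈ S := fun y hy => by
      obtain ⟨s, hs, hsy⟩ := exists_lt_of_csInf_lt hne hy
      exact hs y hsy
    have h1 : ‖U (sInf S)‖ ^ 2 = 1 := by
      have hcl : IsClosed {y | ‖U y‖ ^ 2 = 1} := isClosed_eq (by fun_prop) continuous_const
      have := closure_minimal (s := Ioi (sInf S)) (fun y hy => hS1 _ hmem y hy) hcl
      rw [closure_Ioi] at this
      exact this self_mem_Ici
    have h2 : N (sInf S) < 0 := by simp only [hN, h1]; linarith
    obtain ⟨ε, hε, hball⟩ := Metric.eventually_nhds_iff.1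
      (hNc.continuousAt.eventually (gt_mem_nhds h2))
    have h3 : sInf S - ε / 2 ∈ S := fun y hy => by
      rcases le_or_gt y (sInf S) with h4 | h4
      · exact hball (by rw [Real.dist_eq, abs_lt]; constructor <;> linarith)
      · exact hmem y h4
    linarith [csInf_le hbdd h3]
  · rw [not_bddBelow_iff] at hbdd
    obtain ⟨a, ha, hax⟩ := hbdd x
    exact hS1 a ha x hax

theorem ne_of_nonpos (hκ : κ ≤ 0) (z : ℂ) : 1 - 2 * κ * ‖z‖ ^ 2 ≠ 0 := by
  nlinarith [mul_nonneg (neg_nonneg.2 hκ) (sq_nonneg ‖z‖)]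

/-- Bootstrap on the system for `(U, F)`, whose right-hand side is rational with nonvanishing
denominator. -/
theorem contDiff (h : WeakProfile c κ U F g) (hκ : κ ≤ 0) : ContDiff ℝ ∞ U := by
  have hU (x : ℝ) := h.hasDerivAt (ne_of_nonpos hκ (U x))
  have hF (x : ℝ) := h.hasDerivAt_flux (ne_of_nonpos hκ (U x))
  have hU' : deriv U = fun x => velocity κ (U x) (F x) := funext fun x => (hU x).deriv
  have hF' : deriv F = fun x => source c κ (U x) (velocity κ (U x) (F x)) :=
    funext fun x => (hF x).deriv
  have key (n : ℕ) : ContDiff ℝ n U ∧ ContDiff ℝ n F := by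
    induction n with
    | zero => exact ⟨contDiff_zero.2 h.continuous, contDiff_zero.2 h.continuous_flux⟩
    | succ n ih =>
      obtain ⟨i1, i2⟩ := ih
      have hV : ContDiff ℝ n fun x => velocity κ (U x) (F x) := by
        unfold velocity
        exact i2.add (((contDiff_const.mul (i1.inner ℝ i2)).div
          (contDiff_const.sub (contDiff_const.mul (i1.norm_sq ℝ)))
          (fun x => ne_of_nonpos hκ (U x))).smul i1)
      have hS : ContDiff ℝ n fun x => source c κ (U x) (velocity κ (U x) (F x)) := by
        unfold source
        exact (((contDiff_const.mul hV).add (i1.mul (Complex.ofRealCLM.contDiff.comp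
          (contDiff_const.sub (i1.norm_sq ℝ))))).add
          ((contDiff_const.mul (i1.inner ℝ hV)).smul hV)).neg
      push_cast
      rw [contDiff_succ_iff_deriv, contDiff_succ_iff_deriv, hU', hF']
      exact ⟨⟨fun x => (hU x).differentiableAt, by simp, hV⟩,
        fun x => (hF x).differentiableAt, by simp, hS⟩
  exact contDiff_infty.2 fun n => (key n).1

/-- Since `η = 1 - |U|²` tends to zero at both ends, `η²` attains a positive maximum; squaring
avoids assuming a sign of `η`. There `η' = 0`, and the intensity equation fixes `|U|`. -/
theorem exists_max (h : WeakProfile c κ U F g) (hκ : κ ≤ 0)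
    (hne : ∃ x, ‖U x‖ ^ 2 ≠ 1) :
    ∃ x₀, (∀ x, (1 - ‖U x‖ ^ 2) ^ 2 ≤ (1 - ‖U x₀‖ ^ 2) ^ 2) ∧ ‖U x₀‖ ^ 2 ≠ 1 ∧
      2 * ‖U x₀‖ ^ 2 = c ^ 2 ∧ inner ℝ (U x₀) (velocity κ (U x₀) (F x₀)) = 0 := by
  obtain ⟨x₁, hx₁⟩ := hne
  have hUc := h.continuous
  have hpos : 0 < (1 - ‖U x₁‖ ^ 2) ^ 2 := by
    have : 1 - ‖U x₁‖ ^ 2 ≠ 0 := fun h => hx₁ (by linarith)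
    positivity
  have hlim {l : Filter ℝ} (hl : Tendsto (fun x => ‖U x‖ ^ 2) l (𝓝 1)) :
      ∀ᶠ x in l, (1 - ‖U x‖ ^ 2) ^ 2 ≤ (1 - ‖U x₁‖ ^ 2) ^ 2 := by
    have : Tendsto (fun x => (1 - ‖U x‖ ^ 2) ^ 2) l (𝓝 ((1 - 1) ^ 2)) :=
      (tendsto_const_nhds.sub hl).pow 2
    exact this.eventually (ge_mem_nhds (by simpa using hpos))
  obtain ⟨x₀, hx₀⟩ := Continuous.exists_forall_ge' (f := fun x => (1 - ‖U x‖ ^ 2) ^ 2)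
    (by fun_prop) x₁ (by
      rw [cocompact_eq_atBot_atTop]
      exact eventually_sup.2 ⟨hlim (h.tendsto_norm_sq fun _ => tendsto_window_atBot),
        hlim (h.tendsto_norm_sq fun _ => tendsto_window_atTop)⟩)
  have hx0 : ‖U x₀‖ ^ 2 ≠ 1 := fun h1 => by
    have := hx₀ x₁
    rw [h1] at this
    simp only [sub_self] at this
    linarith
  have hη : 1 - ‖U x₀‖ ^ 2 ≠ 0 := fun h => hx0 (by linarith)
  have hd := ne_of_nonpos hκ
  have h1 := (((h.hasDerivAt_norm_sq (hd (U x₀))).const_sub 1).pow 2)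
  have hmax : IsLocalMax ((fun x => 1 - ‖U x‖ ^ 2) ^ 2) x₀ := Eventually.of_forall hx₀
  have h2 := hmax.hasDerivAt_eq_zero h1
  have hσ : inner ℝ (U x₀) (velocity κ (U x₀) (F x₀)) = 0 := by
    simpa [hη] using h2
  have h3 := h.intensity_eq (b := x₀ - 1) (fun y _ => hd (U y)) (by linarith : x₀ - 1 < x₀)
  rw [hσ] at h3
  have h4 : 2 * ‖U x₀‖ ^ 2 - c ^ 2 = 0 := by
    have : (1 - ‖U x₀‖ ^ 2) ^ 2 ≠ 0 := pow_ne_zero 2 hη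
    have h5 : (1 - ‖U x₀‖ ^ 2) ^ 2 * (2 * ‖U x₀‖ ^ 2 - c ^ 2) = 0 := by rw [← h3]; ring
    exact (mul_eq_zero.1 h5).resolve_left this
  exact ⟨x₀, hx₀, hx0, by linarith, hσ⟩

/-- The intensity of a nonconstant solution consists of two half-profiles. -/
theorem exists_halfProfile (h : WeakProfile c κ U F g) (hκ : κ ≤ 0) (hc : c ^ 2 < 2)
    (hne : ∃ x, ‖U x‖ ^ 2 ≠ 1) :
    ∃ x₀, ∃ e' e'' : ℝ → ℝ, HalfProfile c κ (fun t => 1 - ‖U (x₀ + t)‖ ^ 2) e' ∧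
      HalfProfile c κ (fun t => 1 - ‖U (x₀ - t)‖ ^ 2) e'' := by
  obtain ⟨x₀, hmax, -, h0, hσ₀⟩ := h.exists_max hκ hne
  refine ⟨x₀, ?_⟩
  have hUc := h.continuous
  have hd (x : ℝ) := ne_of_nonpos hκ (U x)
  have hd1 (x : ℝ) : 1 ≤ 1 - 2 * κ * ‖U x‖ ^ 2 := by
    nlinarith [mul_nonneg (neg_nonneg.2 hκ) (sq_nonneg ‖U x‖)]
  set σ : ℝ → ℝ := fun x => inner ℝ (U x) (velocity κ (U x) (F x)) with hσ
  set η : ℝ → ℝ := fun x => 1 - ‖U x‖ ^ 2 with hη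
  have hηd (x : ℝ) : HasDerivAt η (-(2 * σ x)) x := (h.hasDerivAt_norm_sq (hd x)).const_sub 1
  have hη0 : η x₀ = 1 - c ^ 2 / 2 := by simp only [hη]; linarith
  have hη0pos : 0 < η x₀ := by rw [hη0]; linarith
  have hI (x : ℝ) : 4 * σ x ^ 2 * (1 - 2 * κ * ‖U x‖ ^ 2) = η x ^ 2 * (2 * ‖U x‖ ^ 2 - c ^ 2) :=
    h.intensity_eq (b := x - 1) (fun y _ => hd y) (by linarith : x - 1 < x)
  -- Maximality of `η²` gives `|U|² ≤ 2`, hence `2|U|² - c² ≤ 4`, while `1 - 2κ|U|² ≥ 1`; this feeds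
  -- the Gronwall lemma.
  have hbound (x : ℝ) : |-(2 * σ x)| ≤ 2 * |η x| := by
    have h1 : |η x| ≤ |η x₀| := sq_le_sq.1 (hmax x)
    rw [abs_of_pos hη0pos] at h1
    have h2 : ‖U x‖ ^ 2 ≤ 2 := by
      have := (abs_le.1 h1).1
      simp only [hη] at this hη0
      nlinarith [sq_nonneg c]
    have h3 : (2 * σ x) ^ 2 ≤ (2 * η x) ^ 2 := by
      have h4 := hI x
      have h5 := mul_le_mul_of_nonneg_left (hd1 x) (by positivity : 0 ≤ 4 * σ x ^ 2)
      have h6 : η x ^ 2 * (2 * ‖U x‖ ^ 2 - c ^ 2) ≤ η x ^ 2 * 4 :=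
        mul_le_mul_of_nonneg_left (by nlinarith [sq_nonneg c]) (sq_nonneg _)
      linarith
    have h7 := sq_le_sq.1 h3
    rw [abs_neg]
    rwa [abs_mul 2 (η x), abs_two] at h7
  have hηne := ne_zero_of_abs_deriv_le hηd hbound hη0pos.ne'
  have hηc : Continuous η := by fun_prop
  have hηpos (x : ℝ) : 0 < η x := by
    by_contra hx
    obtain ⟨y, hy⟩ := mem_range_of_exists_le_of_exists_ge hηc ⟨x, not_lt.1 hx⟩ ⟨x₀, hη0pos.le⟩
    exact hηne y hy
  set m : ℝ → ℝ := fun x => inner ℝ (U x) (F x) with hm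
  have hmσ (x : ℝ) : σ x = m x / (1 - 2 * κ * ‖U x‖ ^ 2) := inner_velocity (hd x)
  -- At a critical point `2|U|² = c²`, and the first integrals reduce the derivative of `m` to
  -- `η²/2`.
  have hzero (x : ℝ) (hx : m x = 0) : 0 < ‖velocity κ (U x) (F x)‖ ^ 2
        - 4 * κ * (inner ℝ (U x) (velocity κ (U x) (F x))) ^ 2
        + c * inner ℝ (Complex.I * U x) (velocity κ (U x) (F x))
        - ‖U x‖ ^ 2 * (1 - ‖U x‖ ^ 2) := by
    have hs : σ x = 0 := by rw [hmσ, hx, zero_div]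
    have h1 := h.energy_eq (b := x - 1) (fun y _ => hd y) (by linarith : x - 1 < x)
    have h2 := h.angular_eq (b := x - 1) (fun y _ => hd y) (by linarith : x - 1 < x)
    rw [h1, h2]
    have h3 := hI x
    change 0 < 2 * κ * σ x ^ 2 + η x ^ 2 / 2 - 4 * κ * σ x ^ 2 + c * (c / 2 * η x)
      - ‖U x‖ ^ 2 * η x
    rw [hs] at h3 ⊢
    have h4 : 2 * ‖U x‖ ^ 2 - c ^ 2 = 0 := by
      have h5 : η x ^ 2 * (2 * ‖U x‖ ^ 2 - c ^ 2) = 0 := by rw [← h3]; ring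
      exact (mul_eq_zero.1 h5).resolve_left (pow_ne_zero 2 (hηne x))
    have h6 : 0 < η x ^ 2 := pow_pos (hηpos x) 2
    nlinarith
  have hm0 : m x₀ = 0 := by
    have := hmσ x₀
    rw [show σ x₀ = 0 from hσ₀, eq_comm, div_eq_zero_iff] at this
    exact this.resolve_right (hd x₀)
  have hmd (x : ℝ) := h.hasDerivAt_radial (hd x)
  have hdpos (x : ℝ) : 0 < 1 - 2 * κ * ‖U x‖ ^ 2 := one_pos.trans_le (hd1 x)
  have hσp (x : ℝ) (hx : x₀ < x) : 0 < σ x := by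
    rw [hmσ]
    exact div_pos (pos_of_deriv_pos_at_zeros hmd hzero hm0 hx) (hdpos x)
  have hσn (x : ℝ) (hx : x < x₀) : σ x < 0 := by
    rw [hmσ]
    exact div_neg_of_neg_of_pos (neg_of_deriv_pos_at_zeros hmd hzero hm0 hx) (hdpos x)
  have hanti : StrictAntiOn η (Ici x₀) :=
    strictAntiOn_of_deriv_neg (convex_Ici _) hηc.continuousOn fun x hx => by
      rw [interior_Ici] at hx
      rw [(hηd x).deriv]
      linarith [hσp x hx]
  have hmono : StrictMonoOn η (Iic x₀) :=
    strictMonoOn_of_deriv_pos (convex_Iic _) hηc.continuousOn fun x hx => by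
      rw [interior_Iic] at hx
      rw [(hηd x).deriv]
      linarith [hσn x hx]
  have heqn (x s : ℝ) (hs : s ^ 2 = 4 * σ x ^ 2) :
      s ^ 2 * (1 - 2 * κ + 2 * κ * η x) = η x ^ 2 * (2 - c ^ 2 - 2 * η x) := by
    rw [hs]
    have := hI x
    simp only [hη] at this ⊢
    linear_combination this
  refine ⟨fun t => -(2 * σ (x₀ + t)), fun t => 2 * σ (x₀ - t), ⟨?_, ?_, ?_, ?_, ?_, ?_, ?_⟩,
    ⟨?_, ?_, ?_, ?_, ?_, ?_, ?_⟩⟩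
  · fun_prop
  · simpa only [add_zero] using hη0
  · exact fun t _ => hηpos _
  · intro t ht
    rw [← hη0]
    exact hanti self_mem_Ici (by simp [ht.le]) (by linarith)
  · intro t _
    exact ((hηd (x₀ + t)).scomp t ((hasDerivAt_id t).const_add x₀)).congr_deriv (by simp)
  · intro t ht
    linarith [hσp (x₀ + t) (by linarith)]
  · exact fun t _ => heqn _ _ (by ring)
  · fun_prop
  · simpa only [sub_zero] using hη0
  · exact fun t _ => hηpos _
  · intro t ht
    rw [← hη0]
    exact hmono (by simp [ht.le]) self_mem_Iic (by linarith)
  · intro t _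
    exact ((hηd (x₀ - t)).scomp t ((hasDerivAt_id t).const_sub x₀)).congr_deriv (by simp)
  · intro t ht
    linarith [hσn (x₀ - t) (by linarith)]
  · exact fun t _ => heqn _ _ (by ring)

end WeakProfile

/-! ### Reconstruction of the phase -/

namespace WeakProfile

variable {c κ : ℝ} {U F g : ℝ → ℂ}

/-- The velocity expanded in the frame `U`, `iU`, with angular component given by the first
integral. -/
theorem sq_norm_mul_velocity (h : WeakProfile c κ U F g) (hκ : κ ≤ 0) (x : ℝ) :
    ((‖U x‖ ^ 2 : ℝ) : ℂ) * velocity κ (U x) (F x)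
      = ((inner ℝ (U x) (velocity κ (U x) (F x)) : ℝ)
        + Complex.I * ((c / 2 * (1 - ‖U x‖ ^ 2) : ℝ) : ℂ)) * U x := by
  rw [← h.angular_eq (b := x - 1) (fun y _ => ne_of_nonpos hκ (U y)) (by linarith : x - 1 < x)]
  apply Complex.ext <;>
  · simp [Complex.inner, Complex.sq_norm, Complex.normSq_apply, -Complex.ofReal_pow]
    ring

/-- On an interval without zeros the solution is determined by its modulus up to a constant phase,
once an antiderivative `θ` of the phase velocity is known. -/
theorem exists_phase (h : WeakProfile c κ U F g) (hκ : κ ≤ 0) {s : Set ℝ} (hs : IsOpen s)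
    (hs' : IsPreconnected s) (hne : s.Nonempty) (hU0 : ∀ x ∈ s, U x ≠ 0) {θ : ℝ → ℝ}
    (hθ : ∀ x ∈ s, HasDerivAt θ (c / 2 * ((1 - ‖U x‖ ^ 2) / ‖U x‖ ^ 2)) x) :
    ∃ q : ℂ, ‖q‖ = 1 ∧
      ∀ x ∈ s, U x = q * ((‖U x‖ : ℂ) * Complex.exp (Complex.I * (θ x : ℂ))) := by
  -- The candidate constant is `U / |U| * exp(-iθ)`; the modulus is written `√(‖U‖²)` because the
  -- derivative of `‖U‖²` is already known.
  set Q : ℝ → ℂ := fun x =>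
    ((√(‖U x‖ ^ 2))⁻¹ : ℝ) • (U x * Complex.exp (-(Complex.I * (θ x : ℂ)))) with hQ
  have hQd (x : ℝ) (hx : x ∈ s) : HasDerivAt Q 0 x := by
    have hr : 0 < ‖U x‖ := norm_pos_iff.2 (hU0 x hx)
    have hr2 : 0 < ‖U x‖ ^ 2 := by positivity
    have hsq : √(‖U x‖ ^ 2) = ‖U x‖ := Real.sqrt_sq hr.le
    have h1 := ((h.hasDerivAt_norm_sq (ne_of_nonpos hκ (U x))).sqrt hr2.ne').inv
      (by rw [hsq]; exact hr.ne')
    have h2 := (h.hasDerivAt (ne_of_nonpos hκ (U x))).mul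
      (((hθ x hx).ofReal_comp.const_mul Complex.I).neg.cexp)
    refine (h1.smul h2).congr_deriv ?_
    have h3 := h.sq_norm_mul_velocity hκ x
    have hV : velocity κ (U x) (F x) = ((inner ℝ (U x) (velocity κ (U x) (F x)) : ℝ)
        + Complex.I * ((c / 2 * (1 - ‖U x‖ ^ 2) : ℝ) : ℂ)) * U x / ((‖U x‖ ^ 2 : ℝ) : ℂ) := by
      rw [← h3, mul_div_cancel_left₀]
      exact_mod_cast hr2.ne'
    simp only [Pi.inv_apply, hsq, Pi.mul_apply]
    generalize inner ℝ (U x) (velocity κ (U x) (F x)) = a at *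
    rw [hV]
    have hrc : (‖U x‖ : ℂ) ≠ 0 := by exact_mod_cast hr.ne'
    simp only [Complex.real_smul]
    push_cast
    field_simp
    ring
  obtain ⟨q, hq⟩ := hs.exists_is_const_of_deriv_eq_zero hs'
    (fun x hx => (hQd x hx).differentiableAt.differentiableWithinAt) (fun x hx => (hQd x hx).deriv)
  have hmain (x : ℝ) (hx : x ∈ s) :
      U x = q * ((‖U x‖ : ℂ) * Complex.exp (Complex.I * (θ x : ℂ))) := by
    have hr : 0 < ‖U x‖ := norm_pos_iff.2 (hU0 x hx)
    have hrc : (‖U x‖ : ℂ) ≠ 0 := by exact_mod_cast hr.ne'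
    rw [← hq x hx, hQ]
    simp only [Real.sqrt_sq hr.le, Complex.real_smul, Complex.exp_neg]
    have := Complex.exp_ne_zero (Complex.I * (θ x : ℂ))
    push_cast
    field_simp
  refine ⟨q, ?_, hmain⟩
  obtain ⟨x, hx⟩ := hne
  have hr : 0 < ‖U x‖ := norm_pos_iff.2 (hU0 x hx)
  have h1 := congrArg norm (hmain x hx)
  rw [norm_mul, norm_mul, mul_comm Complex.I, Complex.norm_exp_ofReal_mul_I, mul_one,
    Complex.norm_real, norm_norm] at h1
  exact mul_right_cancel₀ hr.ne' (by rw [← h1, one_mul])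

theorem exp_arg_of_norm_eq_one {q : ℂ} (hq : ‖q‖ = 1) :
    Complex.exp (Complex.I * (Complex.arg q : ℂ)) = q := by
  have := Complex.norm_mul_exp_arg_mul_I q
  rwa [hq, Complex.ofReal_one, one_mul, mul_comm] at this

/-- The bound on `eta` gives `|U|² ≥ c²/2 > 0`, so one phase constant serves the whole line. -/
theorem eq_gray_soliton (h : WeakProfile c κ U F g) (hκ : κ ≤ 0) (hc0 : c ≠ 0) {x₀ : ℝ}
    (heta : ∀ x, eta c κ (x - x₀) = 1 - ‖U x‖ ^ 2) (hle : ∀ x, eta c κ x ≤ 1 - c ^ 2 / 2) :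
    ∃ φ : ℝ, ∀ x, U x = Complex.exp (Complex.I * (φ : ℂ)) * soliton c κ (x - x₀) := by
  have hpos (x : ℝ) : 0 < ‖U x‖ ^ 2 := by
    have := hle (x - x₀)
    rw [heta] at this
    have : 0 < c ^ 2 := by positivity
    linarith
  have hUc := h.continuous
  have heta' (y : ℝ) : eta c κ y = 1 - ‖U (x₀ + y)‖ ^ 2 := by
    rw [← heta (x₀ + y), add_sub_cancel_left]
  have hint : Continuous fun y => eta c κ y / (1 - eta c κ y) := by
    simp only [heta', sub_sub_cancel]
    exact Continuous.div (by fun_prop) (by fun_prop) fun y => (hpos _).ne'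
  have hθ (x : ℝ) : HasDerivAt (fun x => theta c κ (x - x₀))
      (c / 2 * ((1 - ‖U x‖ ^ 2) / ‖U x‖ ^ 2)) x := by
    have h1 : HasDerivAt (theta c κ) (c / 2 * (eta c κ (x - x₀) / (1 - eta c κ (x - x₀))))
        (x - x₀) :=
      (intervalIntegral.integral_hasDerivAt_right (hint.intervalIntegrable _ _)
        (hint.stronglyMeasurableAtFilter _ _) hint.continuousAt).const_mul _
    rw [heta, sub_sub_cancel] at h1
    exact h1.comp_sub_const x x₀
  obtain ⟨q, hq, hU⟩ := h.exists_phase hκ isOpen_univ isPreconnected_univ univ_nonempty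
    (fun x _ h0 => (hpos x).ne' (by rw [h0]; simp)) (fun x _ => hθ x)
  refine ⟨Complex.arg q, fun x => ?_⟩
  rw [exp_arg_of_norm_eq_one hq, soliton, if_neg hc0, heta, sub_sub_cancel,
    Real.sqrt_sq (norm_nonneg _)]
  exact hU x trivial

/-- With `c = 0` the phase is constant on each side of `x₀`. Comparing the one-sided difference
quotients at `x₀` shows that the two constants are opposite. -/
theorem eq_black_soliton (h : WeakProfile 0 κ U F g) (hκ : κ ≤ 0) {x₀ : ℝ}
    (heta : ∀ x, eta 0 κ (x - x₀) = 1 - ‖U x‖ ^ 2) (h0 : U x₀ = 0)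
    (hne : ∀ x, x ≠ x₀ → U x ≠ 0) :
    ∃ φ : ℝ, ∀ x, U x = Complex.exp (Complex.I * (φ : ℂ)) * soliton 0 κ (x - x₀) := by
  have hθ (x : ℝ) : HasDerivAt (fun _ : ℝ => (0 : ℝ))
      (0 / 2 * ((1 - ‖U x‖ ^ 2) / ‖U x‖ ^ 2)) x := by
    simpa using hasDerivAt_const x (0 : ℝ)
  obtain ⟨q, hq, hU⟩ := h.exists_phase hκ (isOpen_Ioi (a := x₀)) isPreconnected_Ioi nonempty_Ioi
    (fun x hx => hne x (ne_of_gt hx)) (fun x _ => hθ x)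
  obtain ⟨p, hp, hU'⟩ := h.exists_phase hκ (isOpen_Iio (a := x₀)) isPreconnected_Iio nonempty_Iio
    (fun x hx => hne x (ne_of_lt hx)) (fun x _ => hθ x)
  simp only [Complex.ofReal_zero, mul_zero, Complex.exp_zero, mul_one] at hU hU'
  set V := velocity κ (U x₀) (F x₀) with hV
  have hslope : Tendsto (slope U x₀) (𝓝[≠] x₀) (𝓝 V) :=
    hasDerivAt_iff_tendsto_slope.1 (h.hasDerivAt (ne_of_nonpos hκ (U x₀)))
  -- At a zero of `U` the energy identity reads `|V|² = 1/2`.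
  have hVne : V ≠ 0 := fun hV0 => by
    have := h.energy_eq (b := x₀ - 1) (fun y _ => ne_of_nonpos hκ (U y))
      (by linarith : x₀ - 1 < x₀)
    rw [← hV, hV0, h0] at this
    norm_num at this
  have e1 : V = (‖V‖ : ℂ) * q := by
    have h1 : Tendsto (slope U x₀) (𝓝[>] x₀) (𝓝 V) :=
      hslope.mono_left (nhdsWithin_mono x₀ fun x (hx : x₀ < x) => ne_of_gt hx)
    have h2 : Tendsto (fun x => ((‖slope U x₀ x‖ : ℝ) : ℂ) * q) (𝓝[>] x₀) (𝓝 ((‖V‖ : ℂ) * q)) :=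
      ((Complex.continuous_ofReal.tendsto _).comp h1.norm).mul_const q
    refine tendsto_nhds_unique (h1.congr' ?_) h2
    filter_upwards [self_mem_nhdsWithin] with x hx
    have hx' : 0 < x - x₀ := sub_pos.2 hx
    rw [slope_def_module, h0, sub_zero, norm_smul, Real.norm_of_nonneg (inv_pos.2 hx').le,
      Complex.real_smul, Complex.ofReal_mul, mul_assoc, mul_comm (‖U x‖ : ℂ) q, ← hU x hx]
  have e2 : V = -((‖V‖ : ℂ) * p) := by
    have h1 : Tendsto (slope U x₀) (𝓝[<] x₀) (𝓝 V) :=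
      hslope.mono_left (nhdsWithin_mono x₀ fun x (hx : x < x₀) => ne_of_lt hx)
    have h2 : Tendsto (fun x => -(((‖slope U x₀ x‖ : ℝ) : ℂ) * p)) (𝓝[<] x₀)
        (𝓝 (-((‖V‖ : ℂ) * p))) :=
      (((Complex.continuous_ofReal.tendsto _).comp h1.norm).mul_const p).neg
    refine tendsto_nhds_unique (h1.congr' ?_) h2
    filter_upwards [self_mem_nhdsWithin] with x hx
    have hx' : x - x₀ < 0 := sub_neg.2 hx
    rw [slope_def_module, h0, sub_zero, norm_smul, Real.norm_of_nonpos (inv_lt_zero.2 hx').le,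
      Complex.real_smul, Complex.ofReal_mul, mul_assoc, mul_comm (‖U x‖ : ℂ) p, ← hU' x hx,
      Complex.ofReal_neg, neg_mul, neg_neg]
  have hpq : p = -q := by
    have h1 : (‖V‖ : ℂ) ≠ 0 := by exact_mod_cast (norm_pos_iff.2 hVne).ne'
    refine mul_left_cancel₀ h1 ?_
    rw [mul_neg, ← e1, e2, neg_neg, ← e2]
  refine ⟨Complex.arg q, fun x => ?_⟩
  rw [exp_arg_of_norm_eq_one hq, soliton, if_pos rfl, heta, sub_sub_cancel,
    Real.sqrt_sq (norm_nonneg _)]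
  rcases lt_trichotomy x x₀ with hx | rfl | hx
  · rw [if_neg (by linarith), Complex.ofReal_neg, mul_neg, ← neg_mul, ← hpq]
    exact hU' x hx
  · simp [h0]
  · rw [if_pos (by linarith)]
    exact hU x hx

theorem bijOn_and_eq_soliton (h : WeakProfile c κ U F g) (hκ : κ ≤ 0) (hc : c ^ 2 < 2)
    (hne : ∃ x, ‖U x‖ ^ 2 ≠ 1) :
    BijOn (G c κ) (Ic c) (Ici 0) ∧
      ∃ x₀ φ : ℝ, ∀ x, U x = Complex.exp (Complex.I * (φ : ℂ)) * soliton c κ (x - x₀) := by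
  obtain ⟨x₀, e', e'', hR, hL⟩ := h.exists_halfProfile hκ hc hne
  refine ⟨hR.bijOn hc hκ, x₀, ?_⟩
  have heta (x : ℝ) : eta c κ (x - x₀) = 1 - ‖U x‖ ^ 2 := by
    rcases le_total x₀ x with hx | hx
    · rw [hR.eta_eq hc hκ, abs_of_nonneg (sub_nonneg.2 hx), add_sub_cancel]
    · rw [hL.eta_eq hc hκ, abs_of_nonpos (sub_nonpos.2 hx), neg_sub, sub_sub_cancel]
  have hle (x : ℝ) : eta c κ x ≤ 1 - c ^ 2 / 2 := by
    rw [hR.eta_eq hc hκ]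
    exact (hR.mem_Ic hc (abs_nonneg x)).2
  rcases eq_or_ne c 0 with rfl | hc0
  · refine h.eq_black_soliton hκ heta ?_ fun x hx h0 => ?_
    · have := hR.zero
      simpa using this
    · rcases lt_or_gt_of_ne hx with hx | hx
      · have := hL.lt (x₀ - x) (by linarith)
        simp [h0] at this
      · have := hR.lt (x - x₀) (by linarith)
        simp [h0] at this
  · exact h.eq_gray_soliton hκ hc0 heta hle

end WeakProfile

end QGP

/-! ### Parameter cases -/

theorem theorem1p2 (c κ : ℝ) (hc : 0 ≤ c) (u : ℝ → ℂ)
    (hu : u ∈ QGP.EnergySpace) (hsol : QGP.IsWeakSolution c κ u)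
    (hcκ : (c, κ) ∉ QGP.Dtilde ∪ QGP.Ccrit) :
    ∃ v : ℝ → ℂ, u =ᵐ[MeasureTheory.volume] v ∧
      (((c, κ) ∈ QGP.D2 ∧
          Set.BijOn (QGP.G c κ) (QGP.Ic c) (Set.Ici 0) ∧
          ContDiff ℝ ∞ v ∧
          ∃ x₀ φ : ℝ, ∀ x, v x = Complex.exp (Complex.I * (φ : ℂ)) * QGP.soliton c κ (x - x₀)) ∨
        ∃ z : ℂ, ‖z‖ = 1 ∧ ∀ x, v x = z) := by
  obtain ⟨U, F, g, huU, h⟩ := QGP.exists_weakProfile hu hsol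
  refine ⟨U, huU, ?_⟩
  have hκ2 : κ ≠ 1 / 2 := fun h' => hcκ (Or.inr ⟨hc, h'⟩)
  have h1 : ¬(c < √2 ∧ 0 < κ ∧ κ < 1 / 2) := fun h' =>
    hcκ (Or.inl (Or.inl (Or.inl (Or.inl ⟨hc, h'⟩))))
  have h2 : ¬(√2 < c ∧ 1 / 2 < κ) := fun h' => hcκ (Or.inl (Or.inl (Or.inl (Or.inr h'))))
  have h3 : ¬(c = √2 ∧ 0 < κ ∧ κ < 1 / 2) := fun h' => hcκ (Or.inl (Or.inl (Or.inr h')))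
  have h4 : ¬(c = √2 ∧ 1 / 2 < κ) := fun h' => hcκ (Or.inl (Or.inr h'))
  by_cases hone : ∀ x, ‖U x‖ ^ 2 = 1
  · exact Or.inr (h.eq_const_of_norm_sq_eq_one hκ2 hone)
  have hnneg : ¬(1 - 2 * κ) * (2 - c ^ 2) < 0 := fun hneg =>
    hone fun x => h.norm_sq_eq_one_of_neg hneg x
  push Not at hone
  have hlt : c < √2 ↔ c ^ 2 < 2 := Real.lt_sqrt hc
  have hgt : √2 < c → 2 < c ^ 2 := fun h' => (Real.sqrt_lt' (by linarith [Real.sqrt_nonneg 2])).1 h'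
  have heq : c = √2 → c ^ 2 = 2 := fun h' => by rw [h', Real.sq_sqrt zero_le_two]
  have hκ : κ ≤ 0 ∧ c ≤ √2 := by
    rcases lt_or_gt_of_ne hκ2 with hk | hk
    · have hcle : c ≤ √2 := not_lt.1 fun h' => hnneg (by nlinarith [hgt h'])
      refine ⟨not_lt.1 fun h' => ?_, hcle⟩
      rcases hcle.lt_or_eq with h5 | h5
      · exact h1 ⟨h5, h', hk⟩
      · exact h3 ⟨h5, h', hk⟩
    · exfalso
      rcases lt_trichotomy c √2 with h5 | h5 | h5
      · exact hnneg (by nlinarith [hlt.1 h5])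
      · exact h4 ⟨h5, hk⟩
      · exact h2 ⟨h5, hk⟩
  obtain ⟨hκ, hcle⟩ := hκ
  rcases hcle.lt_or_eq with h5 | h5
  · obtain ⟨hbij, hsolU⟩ := h.bijOn_and_eq_soliton hκ (hlt.1 h5) hone
    exact Or.inl ⟨⟨hc, h5, hκ⟩, hbij, h.contDiff hκ, hsolU⟩
  -- For `c = √2` the maximum would have `|U|² = c²/2 = 1`, contradicting `η ≠ 0` there.
  · obtain ⟨x₀, -, hx1, hx2, -⟩ := h.exists_max hκ hone
    exact absurd (by linarith [heq h5]) hx1
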